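/- Let $d\ge 3$, let $T_d$ be the $d$-regular tree with root $o$, and for a vertex $x$ of a graph $G$ let $B_r(x;G)$ be the subgraph of $G$ induced by the vertices at distance at most $r$ from $x$, rooted at $x$. A sequence $(G_n)_{n\ge 1}$ of finite (simple) graphs has random weak limit $T_d$ if for every $r\ge 1$ the probability that a uniformly random vertex $x$ of $G_n$ has $B_r(x;G_n)$ isomorphic to $B_r(o;T_d)$, by a graph isomorphism sending $x$ to $o$, tends to $1$ as $n\to\infty$. A bisection of a finite graph $G$ with vertex set $V(G)$ is a set $S\subseteq V(G)$ with $\bigl||S|-|V(G)\setminus S|\bigr|\le 1$; its size $\mathrm{size}(S)$ is the number of edges that join $S$ to $V(G)\setminus S$. Put $$\mathrm{MinBi}:=\limsup_{n\to\infty}\ \min\Bigl\{\tfrac{\mathrm{size}(S)}{|V(G_n)|}: S\text{ is a bisection of }G_n\Bigr\},\qquad \mathrm{MaxBi}:=\liminf_{n\to\infty}\ \max\Bigl\{\tfrac{\mathrm{size}(S)}{|V(G_n)|}: S\text{ is a bisection of }G_n\Bigr\}.$$ **Theorem.** Let $G_n$ be finite graphs whose random weak limit is $T_d$ and whose average degree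 tends to $d$. If $d=3$, then $$\mathrm{MinBi}<\frac{3}{2\pi}\arccos\sqrt{\tfrac89}\qquad\text{and}\qquad \mathrm{MaxBi}>\frac{3}{2\pi}\arccos\Bigl(-\sqrt{\tfrac89}\Bigr).$$ If $d=4$, then $\mathrm{MinBi}<\frac13$ and $\mathrm{MaxBi}>\frac53$. Numerically, $0.16226015<\frac{3}{2\pi}\arccos\sqrt{8/9}<0.1622602$ and $1.3377398<\frac{3}{2\pi}\arccos(-\sqrt{8/9})<1.33773985$. -/

import Mathlib

open Filter Topology

/-- The vertex set of the `d`-regular tree: reduced words over `d` letters, i.e. words without two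
equal consecutive letters. These are the elements of the free product of `d` copies of `ℤ/2ℤ`. -/
def TreeVertex (d : ℕ) : Type := {w : List (Fin d) // w.IsChain (· ≠ ·)}

/-- The `d`-regular tree `T_d`: two reduced words are adjacent when one of them arises from the
other by prepending a letter (the Cayley graph of the free product of `d` copies of `ℤ/2ℤ`). -/
def regularTree (d : ℕ) : SimpleGraph (TreeVertex d) where
  Adj u v := (∃ i, v.1 = i :: u.1) ∨ (∃ i, u.1 = i :: v.1)
  symm := ⟨fun _ _ h => h.symm⟩
  loopless := ⟨fun u h => by
    rcases h with ⟨i, h⟩ | ⟨i, h⟩ <;> simpa using congrArg List.length h⟩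

/-- The root of `T_d`: the empty word. -/
def treeRoot (d : ℕ) : TreeVertex d := ⟨[], List.isChain_nil⟩

section Graph

variable {V W : Type*}

/-- The set of vertices whose graph distance from `x` is at most `r`
(vertices in other components are at distance `⊤`). -/
def graphBall (G : SimpleGraph V) (x : V) (r : ℕ) : Set V := {y | G.edist x y ≤ r}

theorem self_mem_graphBall (G : SimpleGraph V) (x : V) (r : ℕ) : x ∈ graphBall G x r := by
  simp [graphBall]

/-- The balls `B_r(x; G)` and `B_r(o; H)` (as induced subgraphs) are isomorphic by a graph
isomorphism that sends `x` to `o`. -/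
def RootedBallIso (G : SimpleGraph V) (x : V) (H : SimpleGraph W) (o : W) (r : ℕ) : Prop :=
  ∃ e : G.induce (graphBall G x r) ≃g H.induce (graphBall H o r),
    e ⟨x, self_mem_graphBall G x r⟩ = ⟨o, self_mem_graphBall H o r⟩

open scoped Classical in
/-- The probability that a uniformly random vertex `x` of the finite graph `G` has its ball of
radius `r` rooted isomorphic to the ball of radius `r` around the root of `T_d`. -/
noncomputable def treeBallProb [Fintype V] (G : SimpleGraph V) (d r : ℕ) : ℝ :=
  ((Finset.univ.filter fun x => RootedBallIso G x (regularTree d) (treeRoot d) r).card : ℝ) /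
    (Fintype.card V : ℝ)

open scoped Classical in
/-- The average degree of a finite graph. -/
noncomputable def averageDegree [Fintype V] (G : SimpleGraph V) : ℝ :=
  (∑ x, (G.degree x : ℝ)) / (Fintype.card V : ℝ)

open scoped Classical in
/-- A bisection: a vertex set `S` with `| |S| - |V ∖ S| | ≤ 1`. -/
def IsBisection [Fintype V] (S : Finset V) : Prop := |(S.card : ℤ) - (Sᶜ.card : ℤ)| ≤ 1

open scoped Classical in
/-- The number of edges that join `S` to its complement. -/
noncomputable def cutSize [Fintype V] (G : SimpleGraph V) (S : Finset V) : ℕ :=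
  (G.interedges S Sᶜ).card

open scoped Classical in
/-- The finite set of all bisections of a graph with vertex set `V`. -/
noncomputable def bisections (V : Type*) [Fintype V] : Finset (Finset V) :=
  Finset.univ.filter IsBisection

theorem bisections_nonempty (V : Type*) [Fintype V] : (bisections V).Nonempty := by
  classical
  obtain ⟨S, -, hS⟩ := Finset.exists_subset_card_eq
    (s := (Finset.univ : Finset V)) (n := Fintype.card V / 2)
    (by rw [Finset.card_univ]; exact Nat.div_le_self _ _)
  refine ⟨S, ?_⟩
  have h := Finset.card_add_card_compl S
  simp only [bisections, IsBisection, Finset.mem_filter, Finset.mem_univ, true_and]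
  rw [abs_le]
  have e : ∀ i : DecidableEq V, (@compl (Finset V) (@Finset.booleanAlgebra V _ i).toCompl S).card
      = Fintype.card V - S.card := fun i => by
    rw [Finset.card_compl]
  rw [e]
  omega

/-- The minimum of `size(S) / |V|` over the bisections `S` of `G`. -/
noncomputable def minBisection [Fintype V] (G : SimpleGraph V) : ℝ :=
  (bisections V).inf' (bisections_nonempty V)
    fun S => (cutSize G S : ℝ) / (Fintype.card V : ℝ)

/-- The maximum of `size(S) / |V|` over the bisections `S` of `G`. -/
noncomputable def maxBisection [Fintype V] (G : SimpleGraph V) : ℝ :=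
  (bisections V).sup' (bisections_nonempty V)
    fun S => (cutSize G S : ℝ) / (Fintype.card V : ℝ)

end Graph

section Sequence

variable {V : ℕ → Type*} [∀ n, Fintype (V n)]

/-- The random weak limit of the sequence of finite graphs `G n` is `T_d`. -/
def RandomWeakLimitTree (G : ∀ n, SimpleGraph (V n)) (d : ℕ) : Prop :=
  ∀ r : ℕ, 1 ≤ r → Tendsto (fun n => treeBallProb (G n) d r) atTop (𝓝 1)

/-- `MinBi`, the upper limit of the normalized minimum bisection sizes (in the extended reals, so
that the upper limit always has its usual meaning). -/
noncomputable def MinBi (G : ∀ n, SimpleGraph (V n)) : EReal :=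
  limsup (fun n => (minBisection (G n) : EReal)) atTop

/-- `MaxBi`, the lower limit of the normalized maximum bisection sizes. -/
noncomputable def MaxBi (G : ∀ n, SimpleGraph (V n)) : EReal :=
  liminf (fun n => (maxBisection (G n) : EReal)) atTop

end Sequence

/-! Put q = d − 1 and b = 1/√q. Attach independent standard Gaussian labels to the vertices of the
finite graph, and to each vertex x the linear form with coefficient (εb)^k on the vertices at
distance k ≤ R. On the tree this is a truncated Gaussian wave at the edge ±2√q of the spectrum. The
signs of these forms are spins; ε = 1 is used for small cuts and ε = −1 for large ones. Around a
tree-like vertex all inner products of these vectors are explicit. As R → ∞ the correlation of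
neighbouring forms tends to ε·2b/(1+b²) = ε·2√q/d, so by the planar sector formula
(`label_sign_corr`) the cut has asymptotic density (d/2π)·arccos(±2√q/d). These are the constants of
the theorem.

Strictness comes from a local improvement. With probability at least some c > 0, independent of R, a
tree-like vertex has the wrong sign relative to all but one of its neighbours
(`IsTreeLike.orthantConst_le_flip`, with a direction from `exists_flip_direction`). Since d ≥ 3,
reversing such a spin helps. Doing so only on an independent set containing at least a 1/(d+1)
fraction of the tree-like vertices makes the gains add (`adjForm_improve`). As c does not depend on
R, a large fixed R makes the truncation loss smaller than the gain.

It remains to balance. The improved spins are centred, and independent at distance more than 2R+3,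
so their sum is O(√N) on average up to the o(N) vertices that are not tree-like. Reversing that many
spins at vertices of degree d costs o(N) edges (`exists_bisection_adjForm`). The degree hypothesis
controls the edges at the remaining vertices. Some labelling does at least as well as the average
(`exists_bisection_ge`). -/

open MeasureTheory ProbabilityTheory

/-! ### Gaussian measure of planar sectors -/

/-- The standard Gaussian measure of a cone in the plane is proportional to its angle. -/
theorem exists_gaussian_cone_const : ∃ K : ENNReal, ∀ (S : Set (ℝ × ℝ)) (I : Set ℝ),
    MeasurableSet S → MeasurableSet I → I ⊆ Set.Ioo (-Real.pi) Real.pi →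
    (∀ r φ : ℝ, 0 < r → φ ∈ Set.Ioo (-Real.pi) Real.pi →
      ((r * Real.cos φ, r * Real.sin φ) ∈ S ↔ φ ∈ I)) →
    ((gaussianReal 0 1).prod (gaussianReal 0 1)) S = K * volume I := by
  classical
  -- The radial factor of the integral in polar coordinates. It is never evaluated: the total mass 1
  -- of the plane determines it later.
  refine ⟨∫⁻ r in Set.Ioi (0:ℝ), ENNReal.ofReal r *
    ENNReal.ofReal ((2 * Real.pi)⁻¹ * Real.exp (- r ^ 2 / 2)), ?_⟩
  intro S I hS hI hIsub h
  have hpdf : ∀ p : ℝ × ℝ, gaussianPDF 0 1 p.1 * gaussianPDF 0 1 p.2 =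
      ENNReal.ofReal ((2 * Real.pi)⁻¹ * Real.exp (- (p.1 ^ 2 + p.2 ^ 2) / 2)) := by
    intro p
    rw [gaussianPDF, gaussianPDF, ← ENNReal.ofReal_mul (gaussianPDFReal_nonneg _ _ _)]
    congr 1
    simp only [gaussianPDFReal, NNReal.coe_one, mul_one, sub_zero]
    have h2 : (√(2 * Real.pi))⁻¹ * (√(2 * Real.pi))⁻¹ = (2 * Real.pi)⁻¹ := by
      rw [← mul_inv, Real.mul_self_sqrt (by positivity)]
    calc _ = ((√(2 * Real.pi))⁻¹ * (√(2 * Real.pi))⁻¹) *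
        (Real.exp (-p.1 ^ 2 / 2) * Real.exp (-p.2 ^ 2 / 2)) := by ring
      _ = _ := by rw [h2, ← Real.exp_add]; congr 2; ring
  rw [gaussianReal_of_var_ne_zero _ one_ne_zero,
    prod_withDensity (measurable_gaussianPDF 0 1) (measurable_gaussianPDF 0 1),
    withDensity_apply _ hS, ← lintegral_indicator hS, ← Measure.volume_eq_prod,
    ← lintegral_comp_polarCoord_symm]
  simp_rw [hpdf]
  have key : ∀ p ∈ polarCoord.target, ENNReal.ofReal p.1 • S.indicator
      (fun p : ℝ × ℝ => ENNReal.ofReal ((2 * Real.pi)⁻¹ * Real.exp (- (p.1 ^ 2 + p.2 ^ 2) / 2)))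
      (polarCoord.symm p) = (ENNReal.ofReal p.1 *
        ENNReal.ofReal ((2 * Real.pi)⁻¹ * Real.exp (- p.1 ^ 2 / 2))) * I.indicator 1 p.2 := by
    rintro ⟨r, φ⟩ hp
    rw [polarCoord_target] at hp
    have := h r φ hp.1 hp.2
    by_cases hφ : φ ∈ I
    · rw [polarCoord_symm_apply, Set.indicator_of_mem (this.2 hφ), Set.indicator_of_mem hφ]
      simp only [smul_eq_mul, Pi.one_apply, mul_one]
      congr 4
      linear_combination (-r ^ 2 / 2) * Real.sin_sq_add_cos_sq φ
    · rw [polarCoord_symm_apply, Set.indicator_of_notMem (fun h => hφ (this.1 h)),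
        Set.indicator_of_notMem hφ]
      simp
  rw [setLIntegral_congr_fun (by
      rw [polarCoord_target]; exact measurableSet_Ioi.prod measurableSet_Ioo) key,
    polarCoord_target, Measure.volume_eq_prod, ← Measure.prod_restrict,
    lintegral_prod_mul (f := fun r : ℝ => ENNReal.ofReal r *
      ENNReal.ofReal ((2 * Real.pi)⁻¹ * Real.exp (- r ^ 2 / 2))) (g := I.indicator 1)
      (by fun_prop) (measurable_one.indicator hI).aemeasurable, lintegral_indicator_one hI,
    Measure.restrict_apply hI, Set.inter_eq_left.2 hIsub]

/-- The standard Gaussian measure of a planar sector of angle `θ` is `θ / (2π)`. -/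
theorem gaussian_sector (θ : ℝ) (h0 : 0 ≤ θ) (hπ : θ ≤ Real.pi) :
    ((gaussianReal 0 1).prod (gaussianReal 0 1)).real
      {p : ℝ × ℝ | 0 < p.1 ∧ Real.cos θ * p.1 + Real.sin θ * p.2 < 0} = θ / (2 * Real.pi) := by
  obtain ⟨K, hK⟩ := exists_gaussian_cone_const
  have hpi := Real.pi_pos
  -- The whole plane gives K · 2π = 1; the missing ray of angle π is null.
  have h1 := hK Set.univ (Set.Ioo (-Real.pi) Real.pi) MeasurableSet.univ measurableSet_Ioo
    subset_rfl (by simp +contextual)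
  have h2 := hK {p : ℝ × ℝ | 0 < p.1 ∧ Real.cos θ * p.1 + Real.sin θ * p.2 < 0}
    (Set.Ioo (-(Real.pi / 2)) (θ - Real.pi / 2))
    (by measurability) measurableSet_Ioo
    (fun x hx => ⟨by linarith [hx.1], by linarith [hx.2]⟩) (by
      intro r φ hr hφ
      have e : Real.cos θ * (r * Real.cos φ) + Real.sin θ * (r * Real.sin φ) =
        r * Real.cos (φ - θ) := by rw [Real.cos_sub]; ring
      simp only [Set.mem_ofPred_eq, e, mul_pos_iff_of_pos_left hr, Set.mem_Ioo]
      rw [show r * Real.cos (φ - θ) < 0 ↔ Real.cos (φ - θ) < 0 by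
        constructor <;> intro h <;> nlinarith]
      constructor
      · rintro ⟨ha, hb⟩
        have c1 : -(Real.pi / 2) < φ := by
          by_contra! hc
          have := Real.cos_nonpos_of_pi_div_two_le_of_le (x := -φ) (by linarith) (by linarith [hφ.1])
          rw [Real.cos_neg] at this; linarith
        have c2 : φ < Real.pi / 2 := by
          by_contra! hc
          have := Real.cos_nonpos_of_pi_div_two_le_of_le (x := φ) (by linarith) (by linarith [hφ.2])
          linarith
        refine ⟨c1, ?_⟩
        by_contra! hc
        have := Real.cos_nonneg_of_neg_pi_div_two_le_of_le (x := φ - θ) (by linarith) (by linarith)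
        linarith
      · rintro ⟨ha, hb⟩
        refine ⟨Real.cos_pos_of_mem_Ioo ⟨by linarith, by linarith⟩, ?_⟩
        rw [← Real.cos_neg, neg_sub]
        exact Real.cos_neg_of_pi_div_two_lt_of_lt (by linarith) (by linarith))
  rw [measure_univ, Real.volume_Ioo] at h1
  rw [Real.volume_Ioo] at h2
  rw [measureReal_def, h2, ENNReal.toReal_mul, ENNReal.toReal_ofReal (by linarith)]
  have h3 := congrArg ENNReal.toReal h1
  rw [ENNReal.toReal_mul, ENNReal.toReal_ofReal (by linarith), ENNReal.toReal_one] at h3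
  rw [eq_div_iff (by positivity)]
  linear_combination (-θ) * h3

/-! ### Linear forms in independent Gaussian labels -/

section Labels

variable {V : Type*} [Fintype V]

/-- The law of independent standard Gaussian labels. -/
noncomputable def labelLaw (V : Type*) [Fintype V] : Measure (V → ℝ) :=
  Measure.pi fun _ => gaussianReal 0 1

instance : IsProbabilityMeasure (labelLaw V) := by unfold labelLaw; infer_instance

open Matrix

theorem hasGaussianLaw_label_id : HasGaussianLaw (fun g : V → ℝ => g) (labelLaw V) :=
  iIndepFun.hasGaussianLaw (X := fun (i : V) (g : V → ℝ) => g i)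
    (fun i => HasLaw.hasGaussianLaw (μ := gaussianReal 0 1)
      ⟨(measurable_pi_apply i).aemeasurable, (measurePreserving_eval (fun _ : V => gaussianReal 0 1) i).map_eq⟩)
    (iIndepFun_pi (X := fun (_ : V) (t : ℝ) => t) fun _ => by fun_prop)

theorem hasGaussianLaw_label_pair (u v : V → ℝ) :
    HasGaussianLaw (fun g => (u ⬝ᵥ g, v ⬝ᵥ g)) (labelLaw V) := by
  classical
  have := (hasGaussianLaw_label_id (V := V)).map_fun
    (LinearMap.toContinuousLinearMap
      ((dotProductBilin ℝ ℝ u : (V → ℝ) →ₗ[ℝ] ℝ).prod (dotProductBilin ℝ ℝ v)))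
  exact this

theorem hasGaussianLaw_label (u : V → ℝ) :
    HasGaussianLaw (fun g => u ⬝ᵥ g) (labelLaw V) := (hasGaussianLaw_label_pair u u).fst

theorem label_integral (u : V → ℝ) : ∫ g, u ⬝ᵥ g ∂(labelLaw V) = 0 := by
  have hi : ∀ i : V, ∫ g : V → ℝ, g i ∂(labelLaw V) = 0 := fun i => by
    rw [labelLaw, integral_comp_eval (μ := fun _ : V => gaussianReal 0 1) (i := i)
      (f := fun t : ℝ => t) (by fun_prop), integral_id_gaussianReal]
  simp only [dotProduct]
  rw [integral_finsetSum _ fun i _ => ?_]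
  · simp [integral_const_mul, hi]
  · exact ((hasGaussianLaw_label_id (V := V)).eval i).integrable.const_mul _

theorem label_cov (u v : V → ℝ) :
    cov[fun g => u ⬝ᵥ g, fun g => v ⬝ᵥ g; labelLaw V] = u ⬝ᵥ v := by
  classical
  have hm : ∀ i : V, MemLp (fun g : V → ℝ => g i) 2 (labelLaw V) := fun i =>
    ((hasGaussianLaw_label_id (V := V)).eval i).memLp_two
  have hi : ∀ i j : V, cov[fun g => g i, fun g => g j; labelLaw V] = if i = j then 1 else 0 := by
    intro i j
    split_ifs with h
    · subst h
      rw [covariance_self (measurable_pi_apply i).aemeasurable]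
      have hl : HasLaw (fun g : V → ℝ => g i) (gaussianReal 0 1) (labelLaw V) :=
        ⟨(measurable_pi_apply i).aemeasurable, (measurePreserving_eval (fun _ : V => gaussianReal 0 1) i).map_eq⟩
      rw [hl.variance_eq]
      simp
    · refine IndepFun.covariance_eq_zero ?_ (hm i) (hm j)
      exact (iIndepFun_pi (μ := fun _ : V => gaussianReal 0 1)
        (X := fun (_ : V) (t : ℝ) => t) fun _ => by fun_prop).indepFun h
  simp only [dotProduct]
  rw [covariance_fun_sum_fun_sum (fun i => (hm i).const_mul _) (fun i => (hm i).const_mul _)]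
  simp [covariance_const_mul_left, covariance_const_mul_right, hi, mul_comm]

theorem label_map (u : V → ℝ) :
    (labelLaw V).map (fun g => u ⬝ᵥ g) = gaussianReal 0 (u ⬝ᵥ u).toNNReal := by
  have h := hasGaussianLaw_label u
  rw [h.map_eq_gaussianReal, label_integral, ← covariance_self h.aemeasurable, label_cov]

theorem label_indep {u v : V → ℝ} (h : u ⬝ᵥ v = 0) :
    IndepFun (fun g => u ⬝ᵥ g) (fun g => v ⬝ᵥ g) (labelLaw V) :=
  (hasGaussianLaw_label_pair u v).indepFun_of_covariance_eq_zero (by rw [label_cov, h])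

end Labels

theorem measurableSet_sector (a b : ℝ) :
    MeasurableSet {p : ℝ × ℝ | 0 < p.1 ∧ a * p.1 + b * p.2 < 0} := by
  measurability

/-! ### Sign correlations and orthant probabilities -/

section Labels

variable {V : Type*} [Fintype V]

open Matrix

theorem label_map_pair {u v : V → ℝ} (hu : u ⬝ᵥ u = 1) (hv : v ⬝ᵥ v = 1) (h : u ⬝ᵥ v = 0) :
    (labelLaw V).map (fun g => (u ⬝ᵥ g, v ⬝ᵥ g)) =
      (gaussianReal 0 1).prod (gaussianReal 0 1) := by
  rw [(indepFun_iff_map_prod_eq_prod_map_map (hasGaussianLaw_label u).aemeasurable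
    (hasGaussianLaw_label v).aemeasurable).1 (label_indep h), label_map, label_map, hu, hv]
  simp

@[fun_prop]
theorem measurable_dotProduct_label (u : V → ℝ) : Measurable fun g : V → ℝ => u ⬝ᵥ g := by
  unfold dotProduct
  fun_prop

theorem label_ae_ne_zero {u : V → ℝ} (hu : u ≠ 0) : ∀ᵐ g ∂(labelLaw V), u ⬝ᵥ g ≠ 0 := by
  have h := label_map u
  have h0 : (u ⬝ᵥ u).toNNReal ≠ 0 := by
    have : 0 < u ⬝ᵥ u := lt_of_le_of_ne (by
      simp only [dotProduct]; exact Finset.sum_nonneg fun i _ => mul_self_nonneg _)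
      (Ne.symm fun h => hu (dotProduct_self_eq_zero.1 h))
    simpa using this
  have := nullSingletonClass_gaussianReal (μ := 0) h0
  have h1 : (labelLaw V).map (fun g => u ⬝ᵥ g) {0} = 0 := by rw [h]; exact measure_singleton 0
  rw [Measure.map_apply (by fun_prop) (measurableSet_singleton 0)] at h1
  rw [ae_iff]
  convert h1 using 2
  ext g
  simp

/-- The probability that a Gaussian hyperplane separates two unit-scale vectors, in one order. -/
theorem label_sector {u v : V → ℝ} {N : ℝ} (hN : 0 < N) (hu : u ⬝ᵥ u = N) (hv : v ⬝ᵥ v = N)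
    (h1 : -N < u ⬝ᵥ v) (h2 : u ⬝ᵥ v < N) :
    (labelLaw V).real {g | 0 < u ⬝ᵥ g ∧ v ⬝ᵥ g < 0} =
      Real.arccos (u ⬝ᵥ v / N) / (2 * Real.pi) := by
  set ρ := u ⬝ᵥ v / N with hρ
  have huv : u ⬝ᵥ v = ρ * N := by rw [hρ]; field_simp
  have hρ1 : -1 < ρ := by rw [hρ, lt_div_iff₀ hN]; linarith
  have hρ2 : ρ < 1 := by rw [hρ, div_lt_iff₀ hN]; linarith
  set σ := Real.sqrt (1 - ρ ^ 2) with hσ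
  have hσ2 : σ ^ 2 = 1 - ρ ^ 2 := Real.sq_sqrt (by nlinarith)
  have hσ0 : 0 < σ := Real.sqrt_pos.2 (by nlinarith)
  set m := Real.sqrt N with hm
  have hm2 : m * m = N := Real.mul_self_sqrt hN.le
  have hm0 : 0 < m := Real.sqrt_pos.2 hN
  have hvu : v ⬝ᵥ u = ρ * N := by rw [dotProduct_comm, huv]
  -- Gram–Schmidt: in the orthonormal frame of u/m and (v − ρu)/(mσ), the vector v/m has coordinates
  -- (cos θ, sin θ) with θ = arccos ρ.
  have e1 : (m⁻¹ • u) ⬝ᵥ (m⁻¹ • u) = 1 := by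
    simp only [smul_dotProduct, dotProduct_smul, smul_eq_mul, hu, ← hm2]; field_simp
  have e2 : (m⁻¹ • u) ⬝ᵥ ((m * σ)⁻¹ • (v - ρ • u)) = 0 := by
    simp only [smul_dotProduct, dotProduct_smul, smul_eq_mul, dotProduct_sub, hu, huv]; ring
  have e3 : ((m * σ)⁻¹ • (v - ρ • u)) ⬝ᵥ ((m * σ)⁻¹ • (v - ρ • u)) = 1 := by
    simp only [smul_dotProduct, dotProduct_smul, smul_eq_mul, dotProduct_sub, sub_dotProduct, hu,
      hv, hvu, huv]
    rw [← hm2]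
    field_simp
    linarith
  have hmap := label_map_pair e1 e3 e2
  have hs := gaussian_sector (Real.arccos ρ) (Real.arccos_nonneg ρ) (Real.arccos_le_pi ρ)
  rw [← hs, ← hmap, map_measureReal_apply (by fun_prop) (measurableSet_sector _ _)]
  congr 1
  ext g
  simp only [Set.mem_preimage, Set.mem_ofPred_eq, Real.cos_arccos hρ1.le hρ2.le, Real.sin_arccos,
    smul_dotProduct, sub_dotProduct, smul_eq_mul]
  rw [← hσ, show ρ * (m⁻¹ * (u ⬝ᵥ g)) + σ * ((m * σ)⁻¹ * (v ⬝ᵥ g - ρ * (u ⬝ᵥ g))) =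
    m⁻¹ * (v ⬝ᵥ g) by field_simp; ring, mul_pos_iff_of_pos_left (inv_pos.2 hm0),
    mul_neg_iff]
  simp [hm0, hm0.le]

theorem measurable_sign_real : Measurable Real.sign := by
  unfold Real.sign
  exact Measurable.ite measurableSet_Iio measurable_const
    (Measurable.ite measurableSet_Ioi measurable_const measurable_const)

theorem abs_sign_le_one (r : ℝ) : |Real.sign r| ≤ 1 := by
  rcases Real.sign_apply_eq r with h | h | h <;> simp [h]

/-- The correlation of the signs of two linear forms in Gaussian labels. -/
theorem label_sign_corr {u v : V → ℝ} {N : ℝ} (hN : 0 < N) (hu : u ⬝ᵥ u = N) (hv : v ⬝ᵥ v = N)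
    (h1 : -N < u ⬝ᵥ v) (h2 : u ⬝ᵥ v < N) :
    ∫ g, Real.sign (u ⬝ᵥ g) * Real.sign (v ⬝ᵥ g) ∂(labelLaw V) =
      1 - 2 * Real.arccos (u ⬝ᵥ v / N) / Real.pi := by
  have hu0 : u ≠ 0 := by rintro rfl; simp at hu; linarith
  have hv0 : v ≠ 0 := by rintro rfl; simp at hv; linarith
  have hA : MeasurableSet {g : V → ℝ | 0 < u ⬝ᵥ g ∧ v ⬝ᵥ g < 0} := by
    measurability
  have hB : MeasurableSet {g : V → ℝ | 0 < (-u) ⬝ᵥ g ∧ (-v) ⬝ᵥ g < 0} := by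
    measurability
  -- Almost surely the product is 1 unless the signs differ. The two ways of differing are the same
  -- sector event, for (u, v) and for (−u, −v).
  have e : (fun g => Real.sign (u ⬝ᵥ g) * Real.sign (v ⬝ᵥ g)) =ᵐ[labelLaw V]
      fun g => 1 - 2 * {g : V → ℝ | 0 < u ⬝ᵥ g ∧ v ⬝ᵥ g < 0}.indicator 1 g -
        2 * {g : V → ℝ | 0 < (-u) ⬝ᵥ g ∧ (-v) ⬝ᵥ g < 0}.indicator 1 g := by
    filter_upwards [label_ae_ne_zero hu0, label_ae_ne_zero hv0] with g ha hb
    simp only [Set.indicator, Set.mem_ofPred_eq, neg_dotProduct, Pi.one_apply]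
    rcases lt_or_gt_of_ne ha with ha | ha <;> rcases lt_or_gt_of_ne hb with hb | hb <;>
      simp [Real.sign_of_neg, Real.sign_of_pos, ha, hb, ha.le, hb.le, not_lt.2] <;> norm_num
  rw [integral_congr_ae e, integral_sub, integral_sub, integral_const_mul, integral_const_mul,
    integral_indicator_one hA, integral_indicator_one hB, label_sector hN hu hv h1 h2,
    label_sector hN (u := -u) (v := -v) (by simpa using hu) (by simpa using hv) (by simpa using h1)
      (by simpa using h2)]
  · simp
    ring
  · exact integrable_const _
  · exact ((integrable_const _).indicator hA).const_mul _
  · exact (integrable_const _).sub (((integrable_const _).indicator hA).const_mul _)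
  · exact ((integrable_const _).indicator hB).const_mul _

/-- A lower bound for the probability that `m` standard Gaussian variables, each having correlation
at least `κ` with a common one, are all positive. -/
noncomputable def orthantConst (m : ℕ) (κ : ℝ) : ℝ :=
  (gaussianReal 0 1).real (Set.Ioi (Real.sqrt (2 * m) / κ)) / 2

theorem orthantConst_pos (m : ℕ) (κ : ℝ) : 0 < orthantConst m κ := by
  unfold orthantConst
  refine half_pos (ENNReal.toReal_pos ?_ (measure_ne_top _ _))
  intro h
  have := gaussianReal_absolutelyContinuous' 0 (v := 1) one_ne_zero h
  simp at this

/-- If w·g exceeds K/κ, the component of each form along w exceeds K = √(2m). The remainder is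
independent of w·g and has variance at most 1, so by Chebyshev it reaches −K with probability at
most 1/(2m). A union bound over at most m forms loses only half of the event, and no further
knowledge of the covariances is needed. -/
theorem orthantConst_le_label {ι : Type*} (s : Finset ι) (f : ι → V → ℝ) (w : V → ℝ) {m : ℕ}
    {κ : ℝ} (hs : s.card ≤ m) (hm : 0 < m) (hκ : 0 < κ) (hw : w ⬝ᵥ w = 1)
    (hf : ∀ i ∈ s, f i ⬝ᵥ f i = 1) (hfw : ∀ i ∈ s, κ ≤ w ⬝ᵥ f i) :
    orthantConst m κ ≤ (labelLaw V).real {g | ∀ i ∈ s, 0 < f i ⬝ᵥ g} := by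
  classical
  set K := Real.sqrt (2 * m) with hK
  have hK2 : K ^ 2 = 2 * m := Real.sq_sqrt (by positivity)
  have hK0 : 0 < K := Real.sqrt_pos.2 (by positivity)
  let Z : ι → V → ℝ := fun i => f i - (w ⬝ᵥ f i) • w
  let E : Set (V → ℝ) := {g | K / κ < w ⬝ᵥ g}
  let B : ι → Set (V → ℝ) := fun i => {g | K ≤ |Z i ⬝ᵥ g|}
  have hE : (labelLaw V).real E = 2 * orthantConst m κ := by
    have := map_measureReal_apply (μ := labelLaw V) (measurable_dotProduct_label w)
      (measurableSet_Ioi (a := K / κ))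
    rw [label_map, hw] at this
    rw [orthantConst, ← hK]
    simp only [Real.toNNReal_one] at this
    rw [this]
    ring_nf
    rfl
  have hB : ∀ i ∈ s, (labelLaw V).real (E ∩ B i) ≤ (labelLaw V).real E * (1 / (2 * m)) := by
    intro i hi
    have hind : IndepFun (fun g => w ⬝ᵥ g) (fun g => Z i ⬝ᵥ g) (labelLaw V) :=
      label_indep (by simp [Z, dotProduct_sub, hw])
    have h1 := hind.measure_inter_preimage_eq_mul (Set.Ioi (K / κ)) {t | K ≤ |t|}
      measurableSet_Ioi (by measurability)
    have h2 : (labelLaw V).real (E ∩ B i) = (labelLaw V).real E * (labelLaw V).real (B i) := by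
      simp only [measureReal_def]
      rw [← ENNReal.toReal_mul]
      exact congrArg ENNReal.toReal h1
    rw [h2]
    refine mul_le_mul_of_nonneg_left ?_ measureReal_nonneg
    have hL := hasGaussianLaw_label (Z i)
    have h3 := meas_ge_le_variance_div_sq hL.memLp_two hK0
    rw [label_integral] at h3
    have h4 : Var[fun g => Z i ⬝ᵥ g; labelLaw V] ≤ 1 := by
      rw [← covariance_self hL.aemeasurable, label_cov]
      simp only [Z, dotProduct_sub, sub_dotProduct, smul_dotProduct, dotProduct_smul, hw,
        hf i hi, dotProduct_comm (f i) w, smul_eq_mul]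
      nlinarith [sq_nonneg (w ⬝ᵥ f i)]
    rw [measureReal_def]
    refine ENNReal.toReal_le_of_le_ofReal (by positivity) ?_
    simp only [sub_zero] at h3
    refine h3.trans (ENNReal.ofReal_le_ofReal ?_)
    rw [hK2]
    gcongr
  have hsub : E ⊆ {g | ∀ i ∈ s, 0 < f i ⬝ᵥ g} ∪ ⋃ i ∈ s, E ∩ B i := by
    intro g hg
    by_cases h : ∃ i ∈ s, g ∈ B i
    · obtain ⟨i, hi, hgi⟩ := h
      exact Or.inr (Set.mem_biUnion hi ⟨hg, hgi⟩)
    · left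
      push Not at h
      intro i hi
      have h1 : |Z i ⬝ᵥ g| < K := not_le.1 (h i hi)
      have h2 : f i ⬝ᵥ g = (w ⬝ᵥ f i) * (w ⬝ᵥ g) + Z i ⬝ᵥ g := by
        simp [Z, sub_dotProduct]
      have h3 : K / κ < w ⬝ᵥ g := hg
      rw [div_lt_iff₀ hκ] at h3
      have h4 : 0 < w ⬝ᵥ g := pos_of_mul_pos_left (hK0.trans h3) hκ.le
      have := mul_le_mul_of_nonneg_right (hfw i hi) h4.le
      rw [h2]
      linarith [(abs_lt.1 h1).1]
  have h5 := (measureReal_mono (μ := labelLaw V) hsub).trans (measureReal_union_le _ _)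
  have h6 := measureReal_biUnion_finset_le (μ := labelLaw V) s fun i => E ∩ B i
  have h7 := Finset.sum_le_sum hB
  rw [Finset.sum_const, nsmul_eq_mul] at h7
  have h8 : (s.card : ℝ) * ((labelLaw V).real E * (1 / (2 * m))) ≤ (labelLaw V).real E / 2 := by
    have : (s.card : ℝ) ≤ m := by exact_mod_cast hs
    calc _ ≤ (m : ℝ) * ((labelLaw V).real E * (1 / (2 * m))) := by gcongr
      _ = _ := by field_simp
  linarith

end Labels

theorem mem_graphBall {V : Type*} {G : SimpleGraph V} {x z : V} {r : ℕ} :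
    z ∈ graphBall G x r ↔ G.edist x z ≤ r := Iff.rfl

/-! ### Distances and degrees in the regular tree -/

section TreeDistance

variable {d : ℕ}

theorem length_le_of_walk {u v : TreeVertex d} (p : (regularTree d).Walk u v) :
    v.1.length ≤ u.1.length + p.length := by
  induction p with
  | nil => simp
  | cons h p ih =>
    rw [SimpleGraph.Walk.length_cons]
    rcases h with ⟨i, h⟩ | ⟨i, h⟩
    · rw [h, List.length_cons] at ih
      omega
    · rw [h, List.length_cons]
      omega

/-- Word length changes by one along each edge, and deleting leading letters walks to the root. -/
theorem edist_treeRoot (w : TreeVertex d) :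
    (regularTree d).edist (treeRoot d) w = (w.1.length : ℕ∞) := by
  apply le_antisymm
  · obtain ⟨w, hw⟩ := w
    induction w with
    | nil => exact (SimpleGraph.edist_self (G := regularTree d) (v := treeRoot d)).le
    | cons i w ih =>
      have hw' : w.IsChain (· ≠ ·) := hw.tail
      have hadj : (regularTree d).Adj ⟨w, hw'⟩ ⟨i :: w, hw⟩ := Or.inl ⟨i, rfl⟩
      refine ((regularTree d).edist_triangle (v := ⟨w, hw'⟩)).trans ?_
      rw [SimpleGraph.edist_eq_one_iff_adj.2 hadj]
      simpa using add_le_add_left (ih hw') 1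
  · rw [SimpleGraph.edist]
    refine le_iInf fun p => ?_
    have := length_le_of_walk p
    simp only [treeRoot, List.length_nil, zero_add] at this
    exact_mod_cast this

theorem mem_graphBall_treeRoot {w : TreeVertex d} {r : ℕ} :
    w ∈ graphBall (regularTree d) (treeRoot d) r ↔ w.1.length ≤ r := by
  rw [mem_graphBall, edist_treeRoot]
  exact_mod_cast Iff.rfl

/-- Left multiplication by a generator in the free product of `d` copies of `ℤ/2ℤ`. -/
def genMul (w : TreeVertex d) (i : Fin d) : TreeVertex d :=
  if h : w.1.head? = some i then ⟨w.1.tail, List.IsChain.tail w.2⟩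
  else ⟨i :: w.1, by
    refine List.IsChain.cons w.2 fun y hy => ?_
    rintro rfl
    exact h hy⟩

theorem genMul_of_head {w : TreeVertex d} {i : Fin d} (h : w.1.head? = some i) :
    (genMul w i).1 = w.1.tail := by
  have : genMul w i = ⟨w.1.tail, List.IsChain.tail w.2⟩ := dif_pos h
  rw [this]

theorem genMul_of_not_head {w : TreeVertex d} {i : Fin d} (h : w.1.head? ≠ some i) :
    (genMul w i).1 = i :: w.1 := by
  have : genMul w i = ⟨i :: w.1, _⟩ := dif_neg h
  rw [this]

theorem genMul_injective (w : TreeVertex d) : Function.Injective (genMul w) := by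
  intro i j h
  have h := congrArg (fun t : TreeVertex d => t.1) h
  by_cases h1 : w.1.head? = some i <;> by_cases h2 : w.1.head? = some j
  · rw [h1] at h2; exact Option.some_injective _ h2
  · simp only [genMul_of_head h1, genMul_of_not_head h2] at h
    have := congrArg List.length h
    simp at this
  · simp only [genMul_of_head h2, genMul_of_not_head h1] at h
    have := congrArg List.length h
    simp at this
    omega
  · simp only [genMul_of_not_head h1, genMul_of_not_head h2] at h
    exact (List.cons.inj h).1

theorem adj_iff_genMul {w u : TreeVertex d} :
    (regularTree d).Adj w u ↔ ∃ i, genMul w i = u := by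
  constructor
  · rintro (⟨i, h⟩ | ⟨i, h⟩)
    · refine ⟨i, Subtype.ext ?_⟩
      rw [genMul_of_not_head, h]
      intro h1
      have hu := u.2
      rw [h] at hu
      rcases List.head?_eq_some_iff.1 h1 with ⟨t, ht⟩
      rw [ht] at hu
      simp at hu
    · refine ⟨i, Subtype.ext ?_⟩
      rw [genMul_of_head (by rw [h]; rfl), h, List.tail_cons]
  · rintro ⟨i, rfl⟩
    by_cases h : w.1.head? = some i
    · right
      refine ⟨i, ?_⟩
      rw [genMul_of_head h]
      exact (List.cons_head?_tail h).symm
    · exact Or.inl ⟨i, genMul_of_not_head h⟩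

theorem card_neighborSet_regularTree (w : TreeVertex d) :
    Nat.card ((regularTree d).neighborSet w) = d := by
  have : (regularTree d).neighborSet w = Set.range (genMul w) := by
    ext u
    simp [adj_iff_genMul]
  rw [this, Nat.card_congr (Equiv.ofInjective _ (genMul_injective w)).symm]
  simp

end TreeDistance

/-! ### Distances to the centre under a rooted isomorphism of balls -/

section Distance

variable {V W : Type*} {G : SimpleGraph V} {H : SimpleGraph W}

theorem edist_le_add_one_of_adj (x : V) {z z' : V} (h : G.Adj z z') :
    G.edist x z' ≤ G.edist x z + 1 := by
  rw [← SimpleGraph.edist_eq_one_iff_adj.2 h]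
  exact G.edist_triangle

theorem edist_le_add_one_of_adj' {x y : V} (z : V) (h : G.Adj x y) :
    G.edist y z ≤ G.edist x z + 1 := by
  rw [SimpleGraph.edist_comm, SimpleGraph.edist_comm (u := x)]
  exact edist_le_add_one_of_adj z h

theorem exists_adj_edist_eq {x z : V} {k : ℕ} (h : G.edist x z = ((k + 1 : ℕ) : ℕ∞)) :
    ∃ z', G.Adj z z' ∧ G.edist x z' = k := by
  obtain ⟨p, hp⟩ := SimpleGraph.exists_walk_of_edist_eq_coe h
  have hq : p.reverse.length = k + 1 := by simpa using hp
  cases hc : p.reverse with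
  | nil => rw [hc] at hq; simp at hq
  | cons hadj q =>
    rename_i z'
    rw [hc, SimpleGraph.Walk.length_cons] at hq
    refine ⟨z', hadj, le_antisymm ?_ ?_⟩
    · rw [SimpleGraph.edist_comm]
      refine (SimpleGraph.edist_le q).trans ?_
      exact_mod_cast (by omega : q.length ≤ k)
    · have := edist_le_add_one_of_adj x hadj.symm
      rw [h, Nat.cast_add, Nat.cast_one] at this
      exact (ENat.add_le_add_iff_right (by simp)).1 this

/-- A geodesic from the centre stays inside the ball, so the isomorphism of induced subgraphs
carries it to a walk of the same length. Applied to the inverse as well, this identifies the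
distances to the two centres. -/
theorem edist_le_of_ball_iso {x : V} {o : W} {r : ℕ}
    (e : G.induce (graphBall G x r) ≃g H.induce (graphBall H o r))
    (he : e ⟨x, self_mem_graphBall G x r⟩ = ⟨o, self_mem_graphBall H o r⟩) (k : ℕ) :
    ∀ z : graphBall G x r, G.edist x z = k → H.edist o (e z) ≤ k := by
  induction k with
  | zero =>
    intro z hz
    have : z = ⟨x, self_mem_graphBall G x r⟩ := by
      ext
      exact (SimpleGraph.edist_eq_zero_iff.1 (hz.trans Nat.cast_zero)).symm
    rw [this, he]
    simp
  | succ k ih =>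
    intro z hz
    obtain ⟨z', hadj, hz'⟩ := exists_adj_edist_eq hz
    have hmem : z' ∈ graphBall G x r := by
      have := z.2
      rw [mem_graphBall, hz] at this
      rw [mem_graphBall, hz']
      exact le_trans (by simp) this
    have h1 := ih ⟨z', hmem⟩ hz'
    have h2 : H.Adj (e ⟨z', hmem⟩) (e z) := by
      have : (G.induce (graphBall G x r)).Adj ⟨z', hmem⟩ z := hadj.symm
      exact e.map_adj_iff.2 this
    refine (edist_le_add_one_of_adj o h2).trans ?_
    push_cast
    gcongr

theorem edist_ball_iso {x : V} {o : W} {r : ℕ}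
    (e : G.induce (graphBall G x r) ≃g H.induce (graphBall H o r))
    (he : e ⟨x, self_mem_graphBall G x r⟩ = ⟨o, self_mem_graphBall H o r⟩)
    (z : graphBall G x r) : H.edist o (e z) = G.edist x z := by
  apply le_antisymm
  · obtain ⟨k, hk⟩ := ENat.ne_top_iff_exists.1 (ne_top_of_le_ne_top (ENat.natCast_ne_top r) z.2)
    rw [← hk]
    exact edist_le_of_ball_iso e he k z hk.symm
  · obtain ⟨k, hk⟩ := ENat.ne_top_iff_exists.1
      (ne_top_of_le_ne_top (ENat.natCast_ne_top r) (e z).2)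
    rw [← hk]
    have := edist_le_of_ball_iso e.symm (by rw [← he]; simp) k (e z) hk.symm
    simpa using this

end Distance

/-! ### Level structure of a tree-like ball -/

section LocalTree

variable {V : Type*}

/-- The ball of radius `r` around `x` has the level structure of the `d`-regular tree. -/
structure IsTreeLike (G : SimpleGraph V) (d : ℕ) (x : V) (r : ℕ) : Prop where
  card_nbr : ∀ (k : ℕ) (z : V), k < r → G.edist x z = k → Nat.card (G.neighborSet z) = d
  level_nbr : ∀ (k : ℕ) (z z' : V), k < r → G.edist x z = k → G.Adj z z' →
    G.edist x z' = (k + 1 : ℕ) ∨ ∃ j : ℕ, k = j + 1 ∧ G.edist x z' = j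
  parent_unique : ∀ (k : ℕ) (z z₁ z₂ : V), k + 1 < r → G.edist x z = (k + 1 : ℕ) → G.Adj z z₁ →
    G.Adj z z₂ → G.edist x z₁ = k → G.edist x z₂ = k → z₁ = z₂

/-- Under the isomorphism the distance to x becomes word length, so an edge either prepends a letter
or removes the first one. The parent of a word is its tail, hence unique. Nothing else about the
shape of the ball is used later, apart from its cardinality. -/
theorem RootedBallIso.isTreeLike {G : SimpleGraph V} {d r : ℕ} {x : V}
    (h : RootedBallIso G x (regularTree d) (treeRoot d) r) : IsTreeLike G d x r := by
  obtain ⟨e, he⟩ := h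
  have hlen : ∀ z : graphBall G x r, ((e z).1.1.length : ℕ∞) = G.edist x z := fun z => by
    rw [← edist_ball_iso e he z, edist_treeRoot]
  have hmem : ∀ (k : ℕ) (z : V), k ≤ r → G.edist x z = k → z ∈ graphBall G x r := by
    intro k z hk hz
    rw [mem_graphBall, hz]
    exact_mod_cast hk
  have hmem' : ∀ (k : ℕ) (z z' : V), k < r → G.edist x z = k → G.Adj z z' →
      z' ∈ graphBall G x r := by
    intro k z z' hk hz hadj
    have := edist_le_add_one_of_adj x hadj
    rw [hz] at this
    rw [mem_graphBall]
    exact this.trans (by exact_mod_cast hk)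
  have hadj_iff : ∀ z z' : graphBall G x r,
      (regularTree d).Adj (e z).1 (e z').1 ↔ G.Adj z.1 z'.1 := fun z z' => e.map_adj_iff
  refine ⟨?_, ?_, ?_⟩
  · intro k z hk hz
    have hz0 := hmem k z hk.le hz
    have hl := hlen ⟨z, hz0⟩
    rw [hz] at hl
    have hl' : (e ⟨z, hz0⟩).1.1.length = k := by exact_mod_cast hl
    rw [← card_neighborSet_regularTree (e ⟨z, hz0⟩).1]
    refine Nat.card_congr (Equiv.ofBijective (fun z' => ⟨(e ⟨z'.1, hmem' k z z'.1 hk hz z'.2⟩).1,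
      (hadj_iff ⟨z, hz0⟩ ⟨z'.1, _⟩).2 z'.2⟩) ⟨?_, ?_⟩)
    · intro a b hab
      have h1 := congrArg (fun t => t.1) hab
      have h2 := e.injective (Subtype.ext h1)
      exact Subtype.ext (congrArg (fun t => t.1) h2)
    · rintro ⟨w, hw⟩
      have hwm : w ∈ graphBall (regularTree d) (treeRoot d) r := by
        rw [mem_graphBall_treeRoot]
        rcases hw with ⟨i, h⟩ | ⟨i, h⟩
        · rw [h, List.length_cons, hl']; omega
        · rw [h, List.length_cons] at hl'; omega
      refine ⟨⟨(e.symm ⟨w, hwm⟩).1, ?_⟩, ?_⟩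
      · have := hadj_iff ⟨z, hz0⟩ (e.symm ⟨w, hwm⟩)
        rw [e.apply_symm_apply] at this
        exact this.1 hw
      · ext1
        simp
  · intro k z z' hk hz hadj
    have hz0 := hmem k z hk.le hz
    have hz1 := hmem' k z z' hk hz hadj
    have hl := hlen ⟨z, hz0⟩
    have hl1 := hlen ⟨z', hz1⟩
    rw [hz] at hl
    have hl' : (e ⟨z, hz0⟩).1.1.length = k := by exact_mod_cast hl
    rcases (hadj_iff ⟨z, hz0⟩ ⟨z', hz1⟩).2 hadj with ⟨i, h⟩ | ⟨i, h⟩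
    · left
      rw [← hl1, h, List.length_cons, hl']
    · right
      rw [h, List.length_cons] at hl'
      exact ⟨_, hl'.symm, hl1.symm⟩
  · intro k z z₁ z₂ hk hz h1 h2 hz1 hz2
    have hz0 := hmem (k + 1) z hk.le hz
    have hm1 := hmem k z₁ (by omega) hz1
    have hm2 := hmem k z₂ (by omega) hz2
    have hl := hlen ⟨z, hz0⟩
    have hl1 := hlen ⟨z₁, hm1⟩
    have hl2 := hlen ⟨z₂, hm2⟩
    rw [hz] at hl
    rw [hz1] at hl1
    rw [hz2] at hl2
    norm_cast at hl hl1 hl2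
    have key : ∀ w : graphBall G x r, G.Adj z w.1 → (e w).1.1.length = k →
        (e w).1.1 = (e ⟨z, hz0⟩).1.1.tail := by
      intro w hw hlw
      rcases (hadj_iff ⟨z, hz0⟩ w).2 hw with ⟨i, h⟩ | ⟨i, h⟩
      · rw [h, List.length_cons] at hlw; omega
      · rw [h, List.tail_cons]
    have := e.injective (Subtype.ext (Subtype.ext
      ((key ⟨z₁, hm1⟩ h1 hl1).trans (key ⟨z₂, hm2⟩ h2 hl2).symm)))
    exact congrArg (fun t => t.1) this

theorem RootedBallIso.card_ball {G : SimpleGraph V} {d r : ℕ} {x : V}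
    (h : RootedBallIso G x (regularTree d) (treeRoot d) r) :
    Nat.card (graphBall G x r) = Nat.card (graphBall (regularTree d) (treeRoot d) r) := by
  obtain ⟨e, -⟩ := h
  exact Nat.card_congr e.toEquiv

end LocalTree

/-! ### Decomposition of a tree-like ball into branches at the neighbours of the centre -/

section Branches

variable {V : Type*} {G : SimpleGraph V} {d r : ℕ} {x : V}

theorem eq_of_edist_eq_zero {y z : V} (h : G.edist y z = (0 : ℕ)) : y = z :=
  SimpleGraph.edist_eq_zero_iff.1 (h.trans Nat.cast_zero)

theorem exists_edist_eq_of_le {y z : V} {n : ℕ} (h : G.edist y z ≤ n) :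
    ∃ m : ℕ, G.edist y z = m ∧ m ≤ n := by
  obtain ⟨k, hk⟩ := ENat.ne_top_iff_exists.1 (ne_top_of_le_ne_top (ENat.natCast_ne_top n) h)
  refine ⟨k, hk.symm, ?_⟩
  rw [← hk] at h
  exact_mod_cast h

theorem exists_edist_eq_of_adj {y z : V} {n : ℕ} (h : G.Adj x y) (hz : G.edist x z = n) :
    ∃ m : ℕ, G.edist y z = m ∧ m ≤ n + 1 ∧ n ≤ m + 1 := by
  have h1 := edist_le_add_one_of_adj' z h
  rw [hz] at h1
  obtain ⟨m, hm, hmn⟩ := exists_edist_eq_of_le (n := n + 1) (by exact_mod_cast h1)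
  refine ⟨m, hm, hmn, ?_⟩
  have h2 := edist_le_add_one_of_adj' z h.symm
  rw [hz, hm] at h2
  exact_mod_cast h2

theorem edist_inj {y z : V} {m n : ℕ} (h : G.edist y z = m) (h' : G.edist y z = n) : m = n := by
  rw [h] at h'
  exact_mod_cast h'

theorem exists_branch (k : ℕ) :
    ∀ z, G.edist x z = (k + 1 : ℕ) → ∃ y, G.Adj x y ∧ G.edist y z = k := by
  intro z hz
  induction k generalizing z with
  | zero =>
    exact ⟨z, by simpa using hz, by simp⟩
  | succ k ih =>
    obtain ⟨p, hp, hxp⟩ := exists_adj_edist_eq hz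
    obtain ⟨y, hy, hyp⟩ := ih p hxp
    refine ⟨y, hy, ?_⟩
    have h1 := edist_le_add_one_of_adj y hp.symm
    rw [hyp] at h1
    obtain ⟨m, hm, h2⟩ := exists_edist_eq_of_le (n := k + 1) (by exact_mod_cast h1)
    obtain ⟨m', hm', h3, h4⟩ := exists_edist_eq_of_adj hy hz
    have := edist_inj hm hm'
    rw [hm]
    congr 1
    omega

/-- This is local bipartiteness. If z were equidistant from x and y, so would be its unique
predecessor; descending in this way yields an edge inside level one. -/
theorem IsTreeLike.edist_branch (h : IsTreeLike G d x r) (k : ℕ) (hk : k + 1 < r) :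
    ∀ y z, G.Adj x y → G.edist x z = (k + 1 : ℕ) →
      G.edist y z = k ∨ G.edist y z = (k + 2 : ℕ) := by
  induction k with
  | zero =>
    intro y z hy hz
    obtain ⟨m, hm, h1, h2⟩ := exists_edist_eq_of_adj hy hz
    have : m = 0 ∨ m = 1 ∨ m = 2 := by omega
    rcases this with rfl | rfl | rfl
    · exact Or.inl hm
    · exfalso
      have hyz : G.Adj y z := by simpa using hm
      have hy1 : G.edist x y = (1 : ℕ) := by simpa using hy
      rcases h.level_nbr 1 y z hk hy1 hyz with h3 | ⟨j, h3, h4⟩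
      · exact absurd (edist_inj hz h3) (by omega)
      · exact absurd (edist_inj hz h4) (by omega)
    · exact Or.inr hm
  | succ k ih =>
    intro y z hy hz
    obtain ⟨m, hm, h1, h2⟩ := exists_edist_eq_of_adj hy hz
    have : m = k + 1 ∨ m = k + 2 ∨ m = k + 3 := by omega
    rcases this with rfl | rfl | rfl
    · exact Or.inl hm
    · exfalso
      obtain ⟨z', hz', hyz'⟩ := exists_adj_edist_eq hm
      obtain ⟨p, hp, hxp⟩ := exists_adj_edist_eq hz
      have h5 : z' = p := by
        refine h.parent_unique (k + 1) z z' p (by omega) hz hz' hp ?_ hxp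
        obtain ⟨n, hn, h6, h7⟩ := exists_edist_eq_of_adj hy.symm hyz'
        rcases h.level_nbr (k + 2) z z' hk hz hz' with h3 | ⟨j, h3, h4⟩
        · exact absurd (edist_inj hn h3) (by omega)
        · rw [h4]; congr 1; omega
      subst h5
      rcases ih (by omega) y z' hy hxp with h8 | h8
      · exact absurd (edist_inj hyz' h8) (by omega)
      · exact absurd (edist_inj hyz' h8) (by omega)
    · exact Or.inr hm

/-- The predecessors of z towards y and towards y' are both parents of z with respect to x, so they
coincide and induction applies. -/
theorem IsTreeLike.branch_unique (h : IsTreeLike G d x r) (k : ℕ) (hk : k + 1 < r) :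
    ∀ y y' z, G.Adj x y → G.Adj x y' → G.edist x z = (k + 1 : ℕ) → G.edist y z = k →
      G.edist y' z = k → y = y' := by
  induction k with
  | zero =>
    intro y y' z _ _ _ h1 h2
    exact (eq_of_edist_eq_zero h1).trans
      (eq_of_edist_eq_zero h2).symm
  | succ k ih =>
    intro y y' z hy hy' hz h1 h2
    have key : ∀ y, G.Adj x y → G.edist y z = (k + 1 : ℕ) →
        ∃ p, G.Adj z p ∧ G.edist x p = (k + 1 : ℕ) ∧ G.edist y p = k := by
      intro y hy h1
      obtain ⟨p, hp, hyp⟩ := exists_adj_edist_eq h1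
      refine ⟨p, hp, ?_, hyp⟩
      obtain ⟨n, hn, h6, h7⟩ := exists_edist_eq_of_adj hy.symm hyp
      rcases h.level_nbr (k + 2) z p hk hz hp with h3 | ⟨j, h3, h4⟩
      · exact absurd (edist_inj hn h3) (by omega)
      · rw [h4]; congr 1; omega
    obtain ⟨p, hp, hxp, hyp⟩ := key y hy h1
    obtain ⟨p', hp', hxp', hyp'⟩ := key y' hy' h2
    have := h.parent_unique (k + 1) z p p' (by omega) hz hp hp' hxp hxp'
    subst this
    exact ih (by omega) y y' p hy hy' hxp hyp hyp'

variable [Fintype V]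

open scoped Classical in
/-- The vertices at distance `k + 1` from `x` that descend from its neighbour `y`. -/
noncomputable def branch (G : SimpleGraph V) (x y : V) (k : ℕ) : Finset V :=
  Finset.univ.filter fun z => G.edist x z = (k + 1 : ℕ) ∧ G.edist y z = k

theorem mem_branch {y z : V} {k : ℕ} :
    z ∈ branch G x y k ↔ G.edist x z = (k + 1 : ℕ) ∧ G.edist y z = k := by
  simp [branch]

open scoped Classical in
theorem IsTreeLike.degree_eq (h : IsTreeLike G d x r) {k : ℕ} {z : V} (hk : k < r)
    (hz : G.edist x z = k) : (G.neighborFinset z).card = d := by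
  rw [SimpleGraph.card_neighborFinset_eq_degree, ← h.card_nbr k z hk hz,
    Nat.card_eq_fintype_card, SimpleGraph.card_neighborSet_eq_degree]

open scoped Classical in
theorem IsTreeLike.card_children (h : IsTreeLike G d x r) {k : ℕ} {z : V} (hk : k + 1 < r)
    (hz : G.edist x z = (k + 1 : ℕ)) :
    ((G.neighborFinset z).filter fun z' => G.edist x z' = (k + 2 : ℕ)).card = d - 1 := by
  obtain ⟨p, hp, hxp⟩ := exists_adj_edist_eq hz
  have : (G.neighborFinset z).filter (fun z' => G.edist x z' = (k + 2 : ℕ)) =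
      (G.neighborFinset z).erase p := by
    ext w
    simp only [Finset.mem_filter, SimpleGraph.mem_neighborFinset, Finset.mem_erase]
    constructor
    · rintro ⟨h1, h2⟩
      refine ⟨?_, h1⟩
      rintro rfl
      exact absurd (edist_inj hxp h2) (by omega)
    · rintro ⟨h1, h2⟩
      refine ⟨h2, ?_⟩
      rcases h.level_nbr (k + 1) z w hk hz h2 with h3 | ⟨j, h3, h4⟩
      · exact h3
      · refine absurd (h.parent_unique k z w p hk hz h2 hp ?_ hxp) h1
        rw [h4]; congr 1; omega
  rw [this, Finset.card_erase_of_mem (by simpa using hp), h.degree_eq hk hz]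

/-- Each vertex of a level has d − 1 children, and uniqueness of parents makes the sets of children
disjoint. -/
theorem IsTreeLike.card_branch (h : IsTreeLike G d x r) {y : V} (hy : G.Adj x y) (k : ℕ)
    (hk : k + 1 < r) : (branch G x y k).card = (d - 1) ^ k := by
  classical
  induction k with
  | zero =>
    rw [pow_zero, Finset.card_eq_one]
    refine ⟨y, ?_⟩
    ext z
    rw [mem_branch, Finset.mem_singleton]
    constructor
    · rintro ⟨-, h2⟩
      exact (eq_of_edist_eq_zero h2).symm
    · rintro rfl
      exact ⟨by simpa using hy, by simp⟩
  | succ k ih =>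
    have : branch G x y (k + 1) = (branch G x y k).biUnion fun z =>
        (G.neighborFinset z).filter fun z' => G.edist x z' = (k + 2 : ℕ) := by
      ext z
      simp only [mem_branch, Finset.mem_biUnion, Finset.mem_filter,
        SimpleGraph.mem_neighborFinset]
      constructor
      · rintro ⟨h1, h2⟩
        obtain ⟨p, hp, hyp⟩ := exists_adj_edist_eq h2
        refine ⟨p, ⟨?_, hyp⟩, hp.symm, h1⟩
        obtain ⟨n, hn, h6, h7⟩ := exists_edist_eq_of_adj hy.symm hyp
        rcases h.level_nbr (k + 2) z p hk h1 hp with h3 | ⟨j, h3, h4⟩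
        · exact absurd (edist_inj hn h3) (by omega)
        · rw [h4]; congr 1; omega
      · rintro ⟨p, ⟨h1, h2⟩, h3, h4⟩
        refine ⟨h4, ?_⟩
        have h5 := edist_le_add_one_of_adj y h3
        rw [h2] at h5
        obtain ⟨m, hm, h6⟩ := exists_edist_eq_of_le (n := k + 1) (by exact_mod_cast h5)
        rcases h.edist_branch (k + 1) hk y z hy h4 with h7 | h7
        · exact h7
        · exact absurd (edist_inj hm h7) (by omega)
    rw [this, Finset.card_biUnion, Finset.sum_congr rfl fun z hz =>
      h.card_children (by omega) (mem_branch.1 hz).1, Finset.sum_const, ih (by omega), pow_succ,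
      smul_eq_mul]
    intro z hz z' hz' hne
    rw [Function.onFun, Finset.disjoint_left]
    intro w hw hw'
    simp only [Finset.mem_filter, SimpleGraph.mem_neighborFinset] at hw hw'
    exact hne (h.parent_unique (k + 1) w z z' hk hw.2 hw.1.symm hw'.1.symm
      (mem_branch.1 hz).1 (mem_branch.1 hz').1)

open scoped Classical in
/-- Summation over a tree-like ball by branches. -/
theorem IsTreeLike.sum_eq (h : IsTreeLike G d x r) (n : ℕ) (hn : n < r) (F : V → ℝ)
    (hF : ∀ z, F z ≠ 0 → G.edist x z ≤ n) :
    ∑ z, F z = F x + ∑ k ∈ Finset.range n, ∑ y ∈ G.neighborFinset x,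
      ∑ z ∈ branch G x y k, F z := by
  have h1 : ∀ k < n, ∀ z, (∑ y ∈ G.neighborFinset x, if z ∈ branch G x y k then F z else 0) =
      if G.edist x z = (k + 1 : ℕ) then F z else 0 := by
    intro k hk z
    split_ifs with hz
    · obtain ⟨y, hy, hyz⟩ := exists_branch k z hz
      rw [Finset.sum_eq_single y, if_pos (mem_branch.2 ⟨hz, hyz⟩)]
      · intro y' hy' hne
        rw [if_neg]
        intro hm
        exact hne (h.branch_unique k (by omega) y' y z (by simpa using hy') hy hz
          (mem_branch.1 hm).2 hyz)
      · intro hm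
        exact absurd hy (by simpa using hm)
    · refine Finset.sum_eq_zero fun y _ => if_neg fun hm => hz (mem_branch.1 hm).1
  have h2 : ∀ z, F z = (if z = x then F x else 0) +
      ∑ k ∈ Finset.range n, if G.edist x z = (k + 1 : ℕ) then F z else 0 := by
    intro z
    by_cases hz : F z = 0
    · by_cases hx : z = x
      · subst hx; simp [hz]
      · simp [hz, hx]
    · obtain ⟨m, hm, hmn⟩ := exists_edist_eq_of_le (hF z hz)
      cases m with
      | zero =>
        have : x = z := eq_of_edist_eq_zero hm
        subst this
        rw [if_pos rfl, Finset.sum_eq_zero, add_zero]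
        intro k _
        rw [if_neg]
        intro h3
        exact absurd (edist_inj hm h3) (by omega)
      | succ m =>
        rw [if_neg, zero_add, Finset.sum_eq_single m, if_pos hm]
        · intro k _ hk
          rw [if_neg]
          intro h3
          exact absurd (edist_inj hm h3) (by omega)
        · intro h3
          exact absurd (Finset.mem_range.2 (by omega)) h3
        · rintro rfl
          exact absurd (edist_inj hm (n := 0) (by simp)) (by omega)
  rw [Finset.sum_congr rfl fun z _ => h2 z, Finset.sum_add_distrib, Finset.sum_ite_eq' , if_pos
    (Finset.mem_univ _), Finset.sum_comm]
  congr 1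
  refine Finset.sum_congr rfl fun k hk => ?_
  rw [Finset.sum_congr rfl fun z _ => (h1 k (Finset.mem_range.1 hk) z).symm, Finset.sum_comm]
  refine Finset.sum_congr rfl fun y _ => ?_
  rw [Finset.sum_ite_mem, Finset.univ_inter]

end Branches

/-! ### Truncated radial waves and their Gram matrix -/

section Wave

variable {V : Type*} {G : SimpleGraph V} {d r : ℕ} {x : V}

/-- The radial profile `β ^ k`, cut off at radius `R`. -/
noncomputable def profile (β : ℝ) (R k : ℕ) : ℝ := if k ≤ R then β ^ k else 0

open scoped Classical in
/-- The coefficient vector of the linear factor at `x`: a truncated radial wave. -/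
noncomputable def wave (G : SimpleGraph V) (β : ℝ) (R : ℕ) (x z : V) : ℝ :=
  if G.edist x z ≤ R then profile β R (G.edist x z).toNat else 0

theorem wave_of_edist_eq {β : ℝ} {R k : ℕ} {x z : V} (h : G.edist x z = k) :
    wave G β R x z = profile β R k := by
  rw [wave, h, ENat.toNat_natCast]
  split_ifs with h1
  · rfl
  · rw [profile, if_neg]
    exact_mod_cast h1

theorem edist_le_of_wave_ne_zero {β : ℝ} {R : ℕ} {x z : V} (h : wave G β R x z ≠ 0) :
    G.edist x z ≤ R := by
  by_contra hc
  exact h (if_neg hc)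

/-- Since β²q = 1, the decay β^(2k) cancels the growth q^k of the levels. Every level inside the
cutoff contributes the same amount, so the sum only counts levels. -/
theorem sum_profile (β q : ℝ) (hβ : β ^ 2 * q = 1) (R i j : ℕ) (hij : i ≤ j) (hj : j ≤ R + 1) :
    ∑ k ∈ Finset.range (R + 1), q ^ k * (profile β R (k + i) * profile β R (k + j)) =
      (R + 1 - j) * β ^ (i + j) := by
  have h1 : ∀ k ∈ Finset.range (R + 1),
      q ^ k * (profile β R (k + i) * profile β R (k + j)) =
        if k ∈ Finset.range (R + 1 - j) then β ^ (i + j) else 0 := by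
    intro k _
    by_cases hk : k + j ≤ R
    · rw [if_pos (Finset.mem_range.2 (by omega)), profile, profile, if_pos (by omega), if_pos hk]
      calc _ = (β ^ 2 * q) ^ k * β ^ (i + j) := by ring
        _ = _ := by rw [hβ]; ring
    · rw [if_neg (by simp; omega), profile, profile, if_neg hk]
      simp
  rw [Finset.sum_congr rfl h1, Finset.sum_ite_mem, Finset.sum_const, nsmul_eq_mul,
    Finset.inter_eq_right.2 (Finset.range_subset_range.2 (by omega)), Finset.card_range,
    Nat.cast_sub hj]
  push_cast
  ring

section Gram

open Matrix

variable {β q : ℝ} {R : ℕ}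

theorem degree_sub_one_cast (hd : (d : ℝ) = q + 1) (hq : 0 < q) : ((d - 1 : ℕ) : ℝ) = q := by
  have : 0 < d := by
    rcases Nat.eq_zero_or_pos d with h0 | h0
    · rw [h0] at hd; push_cast at hd; linarith
    · exact h0
  rw [Nat.cast_sub this, hd]
  simp

theorem edist_le_of_wave_nbr_ne_zero {y z : V} (hy : G.Adj x y) (h : wave G β R y z ≠ 0) :
    G.edist x z ≤ (R + 1 : ℕ) := by
  have h1 := edist_le_add_one_of_adj' z hy.symm
  have h2 := edist_le_of_wave_ne_zero h
  push_cast
  exact h1.trans (by gcongr)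

theorem wave_center (x : V) : wave G β R x x = 1 := by
  rw [wave_of_edist_eq (k := 0) (by simp), profile]
  simp

theorem wave_nbr {y : V} (hR : 1 ≤ R) (hy : G.Adj y x) : wave G β R y x = β := by
  rw [wave_of_edist_eq (k := 1) (by simpa using hy), profile, if_pos hR, pow_one]

variable [Fintype V]

open scoped Classical in
/-- Summation over a tree-like ball of a function that is constant on the branches. -/
theorem IsTreeLike.sum_branch_const (h : IsTreeLike G d x r) (hr : R + 1 < r)
    (hd : (d : ℝ) = q + 1) (hq : 0 < q) (F : V → ℝ)
    (hF : ∀ z, F z ≠ 0 → G.edist x z ≤ (R + 1 : ℕ)) (c : ℕ → V → ℝ)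
    (hc : ∀ k, ∀ y z, G.Adj x y → G.edist x z = (k + 1 : ℕ) → G.edist y z = k →
      (∀ y', G.Adj x y' → y' ≠ y → G.edist y' z = (k + 2 : ℕ)) → F z = c k y) :
    ∑ z, F z = F x + ∑ k ∈ Finset.range (R + 1), q ^ k * ∑ y ∈ G.neighborFinset x, c k y := by
  rw [h.sum_eq (R + 1) hr F hF]
  congr 1
  refine Finset.sum_congr rfl fun k hk => ?_
  have hk := Finset.mem_range.1 hk
  rw [Finset.mul_sum]
  refine Finset.sum_congr rfl fun y hy => ?_
  have hy : G.Adj x y := by simpa using hy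
  have h1 : ∀ z ∈ branch G x y k, F z = c k y := by
    intro z hz
    obtain ⟨h1, h2⟩ := mem_branch.1 hz
    refine hc k y z hy h1 h2 fun y' hy' hne => ?_
    rcases h.edist_branch k (by omega) y' z hy' h1 with h3 | h3
    · exact absurd (h.branch_unique k (by omega) y' y z hy' hy h1 h3 h2) hne
    · exact h3
  rw [Finset.sum_congr rfl h1, Finset.sum_const, h.card_branch hy k (by omega), nsmul_eq_mul]
  push_cast
  rw [degree_sub_one_cast hd hq]

theorem IsTreeLike.wave_self (h : IsTreeLike G d x r) (hr : R + 1 < r) (hd : (d : ℝ) = q + 1)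
    (hq : 0 < q) (hβ : β ^ 2 * q = 1) :
    wave G β R x ⬝ᵥ wave G β R x = 1 + R + R * β ^ 2 := by
  classical
  rw [dotProduct, h.sum_branch_const hr hd hq _ ?_
    (fun k _ => profile β R (k + 1) * profile β R (k + 1))]
  · rw [Finset.sum_congr rfl fun k _ => by
      rw [Finset.sum_const, h.degree_eq (k := 0) (by omega) (by simp), nsmul_eq_mul,
        mul_left_comm], ← Finset.mul_sum, sum_profile β q hβ R 1 1 le_rfl (by omega), wave_center,
      hd]
    push_cast
    linear_combination (R : ℝ) * hβ
  · intro k y z _ h1 _ _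
    rw [wave_of_edist_eq h1]
  · intro z hz
    exact (edist_le_of_wave_ne_zero (left_ne_zero_of_mul hz)).trans (by exact_mod_cast R.le_succ)

theorem IsTreeLike.wave_center_nbr (h : IsTreeLike G d x r) (hr : R + 1 < r)
    (hd : (d : ℝ) = q + 1) (hq : 0 < q) (hβ : β ^ 2 * q = 1) (hR : 1 ≤ R) {y : V}
    (hy : G.Adj x y) :
    wave G β R x ⬝ᵥ wave G β R y = 2 * R * β := by
  classical
  -- A vertex at distance k + 1 from x is at distance k from y on the branch of y, and at distance k
  -- + 2 from y on each of the other q branches.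
  rw [dotProduct, h.sum_branch_const hr hd hq _ ?_
    (fun k y' => if y' = y then profile β R (k + 0) * profile β R (k + 1)
      else profile β R (k + 1) * profile β R (k + 2))]
  · have h1 : ∀ k, q ^ k * (∑ y' ∈ G.neighborFinset x,
        if y' = y then profile β R (k + 0) * profile β R (k + 1)
        else profile β R (k + 1) * profile β R (k + 2)) =
        q ^ k * (profile β R (k + 0) * profile β R (k + 1)) +
          q * (q ^ k * (profile β R (k + 1) * profile β R (k + 2))) := by
      intro k
      rw [← Finset.add_sum_erase _ _ (show y ∈ G.neighborFinset x by simpa using hy), if_pos rfl,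
        Finset.sum_congr rfl fun y' hy' => if_neg (Finset.ne_of_mem_erase hy'), Finset.sum_const,
        Finset.card_erase_of_mem (by simpa using hy), h.degree_eq (k := 0) (by omega) (by simp),
        nsmul_eq_mul, degree_sub_one_cast hd hq]
      ring
    simp_rw [h1]
    rw [Finset.sum_add_distrib, ← Finset.mul_sum, sum_profile β q hβ R 0 1 (by omega) (by omega),
      sum_profile β q hβ R 1 2 (by omega) (by omega), wave_center, wave_nbr hR hy.symm]
    push_cast
    linear_combination (β * (R - 1)) * hβ
  · intro k y' z hy' h1 h2 h3
    rw [wave_of_edist_eq h1]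
    split_ifs with h4
    · subst h4
      rw [wave_of_edist_eq h2, mul_comm]
      rfl
    · rw [wave_of_edist_eq (h3 y hy (Ne.symm h4))]
  · intro z hz
    exact (edist_le_of_wave_ne_zero (left_ne_zero_of_mul hz)).trans (by exact_mod_cast R.le_succ)

theorem IsTreeLike.wave_nbr_self (h : IsTreeLike G d x r) (hr : R + 1 < r)
    (hd : (d : ℝ) = q + 1) (hq : 0 < q) (hβ : β ^ 2 * q = 1) (hR : 1 ≤ R) {y : V}
    (hy : G.Adj x y) :
    wave G β R y ⬝ᵥ wave G β R y = 1 + R + R * β ^ 2 := by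
  classical
  -- The sum is organised around x, not y, because only the ball of x is assumed tree-like.
  rw [dotProduct, h.sum_branch_const hr hd hq _ ?_
    (fun k y' => if y' = y then profile β R (k + 0) * profile β R (k + 0)
      else profile β R (k + 2) * profile β R (k + 2))]
  · have h1 : ∀ k, q ^ k * (∑ y' ∈ G.neighborFinset x,
        if y' = y then profile β R (k + 0) * profile β R (k + 0)
        else profile β R (k + 2) * profile β R (k + 2)) =
        q ^ k * (profile β R (k + 0) * profile β R (k + 0)) +
          q * (q ^ k * (profile β R (k + 2) * profile β R (k + 2))) := by
      intro k
      rw [← Finset.add_sum_erase _ _ (show y ∈ G.neighborFinset x by simpa using hy), if_pos rfl,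
        Finset.sum_congr rfl fun y' hy' => if_neg (Finset.ne_of_mem_erase hy'), Finset.sum_const,
        Finset.card_erase_of_mem (by simpa using hy), h.degree_eq (k := 0) (by omega) (by simp),
        nsmul_eq_mul, degree_sub_one_cast hd hq]
      ring
    simp_rw [h1]
    rw [Finset.sum_add_distrib, ← Finset.mul_sum, sum_profile β q hβ R 0 0 (by omega) (by omega),
      sum_profile β q hβ R 2 2 (by omega) (by omega), wave_nbr hR hy.symm]
    push_cast
    linear_combination (β ^ 2 * (R - 1)) * hβ
  · intro k y' z hy' h1 h2 h3
    split_ifs with h4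
    · subst h4
      rw [wave_of_edist_eq h2]
      rfl
    · rw [wave_of_edist_eq (h3 y hy (Ne.symm h4))]
  · intro z hz
    exact edist_le_of_wave_nbr_ne_zero hy (left_ne_zero_of_mul hz)

theorem IsTreeLike.wave_nbr_nbr (h : IsTreeLike G d x r) (hr : R + 1 < r)
    (hd : (d : ℝ) = q + 1) (hq : 0 < q) (hβ : β ^ 2 * q = 1) (hR : 1 ≤ R) {y y₁ : V}
    (hy : G.Adj x y) (hy₁ : G.Adj x y₁) (hne : y ≠ y₁) :
    wave G β R y ⬝ᵥ wave G β R y₁ =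
      β ^ 2 + 2 * (R - 1) * β ^ 2 + (q - 1) * (R - 1) * β ^ 4 := by
  classical
  rw [dotProduct, h.sum_branch_const hr hd hq _ ?_
    (fun k y' => if y' = y then profile β R (k + 0) * profile β R (k + 2)
      else if y' = y₁ then profile β R (k + 0) * profile β R (k + 2)
      else profile β R (k + 2) * profile β R (k + 2))]
  · have hm : y₁ ∈ (G.neighborFinset x).erase y :=
      Finset.mem_erase.2 ⟨hne.symm, by simpa using hy₁⟩
    have hd2 : ((d - 1 - 1 : ℕ) : ℝ) = q - 1 := by
      have h2 := h.degree_eq (k := 0) (z := x) (by omega) (by simp)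
      have h3 := Finset.card_erase_of_mem (show y ∈ G.neighborFinset x by simpa using hy)
      have h4 := Finset.card_pos.2 ⟨_, hm⟩
      rw [Nat.cast_sub (by omega), degree_sub_one_cast hd hq]
      simp
    have h1 : ∀ k, q ^ k * (∑ y' ∈ G.neighborFinset x,
        if y' = y then profile β R (k + 0) * profile β R (k + 2)
        else if y' = y₁ then profile β R (k + 0) * profile β R (k + 2)
        else profile β R (k + 2) * profile β R (k + 2)) =
        2 * (q ^ k * (profile β R (k + 0) * profile β R (k + 2))) +
          (q - 1) * (q ^ k * (profile β R (k + 2) * profile β R (k + 2))) := by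
      intro k
      rw [← Finset.add_sum_erase _ _ (show y ∈ G.neighborFinset x by simpa using hy), if_pos rfl,
        Finset.sum_congr rfl fun y' hy' => if_neg (Finset.ne_of_mem_erase hy'),
        ← Finset.add_sum_erase _ _ hm, if_pos rfl,
        Finset.sum_congr rfl fun y' hy' => if_neg (Finset.ne_of_mem_erase hy'), Finset.sum_const,
        Finset.card_erase_of_mem hm,
        Finset.card_erase_of_mem (by simpa using hy), h.degree_eq (k := 0) (by omega) (by simp),
        nsmul_eq_mul, hd2]
      ring
    simp_rw [h1]
    rw [Finset.sum_add_distrib, ← Finset.mul_sum, ← Finset.mul_sum,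
      sum_profile β q hβ R 0 2 (by omega) (by omega),
      sum_profile β q hβ R 2 2 (by omega) (by omega), wave_nbr hR hy.symm, wave_nbr hR hy₁.symm]
    push_cast
    ring
  · intro k y' z hy' h1 h2 h3
    split_ifs with h4 h5
    · subst h4
      rw [wave_of_edist_eq h2, wave_of_edist_eq (h3 y₁ hy₁ hne.symm)]
      rfl
    · subst h5
      rw [wave_of_edist_eq h2, wave_of_edist_eq (h3 y hy hne), mul_comm]
      rfl
    · rw [wave_of_edist_eq (h3 y hy (Ne.symm h4)), wave_of_edist_eq (h3 y₁ hy₁ (Ne.symm h5))]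
  · intro z hz
    exact edist_le_of_wave_nbr_ne_zero hy (left_ne_zero_of_mul hz)

end Gram

end Wave

/-! ### Cut sizes as a quadratic form, local improvement and rebalancing -/

section CutForm

open scoped Classical in
/-- The spin configuration of a vertex set. -/
noncomputable def spin {V : Type*} (S : Finset V) (x : V) : ℝ := if x ∈ S then 1 else -1

theorem abs_spin {V : Type*} (S : Finset V) (x : V) : |spin S x| = 1 := by
  unfold spin
  split_ifs <;> simp

variable {V : Type*} [Fintype V] (G : SimpleGraph V)

open scoped Classical in
/-- The sum of `s` over the neighbours of `x`. -/
noncomputable def nbrSum (s : V → ℝ) (x : V) : ℝ := ∑ y ∈ G.neighborFinset x, s y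

/-- The quadratic form of the adjacency matrix. -/
noncomputable def adjForm (s : V → ℝ) : ℝ := ∑ x, s x * nbrSum G s x

open scoped Classical in
theorem nbrSum_eq (s : V → ℝ) (x : V) : nbrSum G s x = ∑ y, if G.Adj x y then s y else 0 := by
  rw [nbrSum, ← Finset.sum_filter]
  congr 1
  ext y
  simp

theorem sum_mul_nbrSum_comm (s t : V → ℝ) :
    ∑ x, s x * nbrSum G t x = ∑ x, t x * nbrSum G s x := by
  classical
  simp only [nbrSum_eq, Finset.mul_sum]
  rw [Finset.sum_comm]
  refine Finset.sum_congr rfl fun x _ => Finset.sum_congr rfl fun y _ => ?_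
  rw [G.adj_comm]
  split_ifs
  · ring
  · simp

theorem nbrSum_add (s t : V → ℝ) (x : V) : nbrSum G (s + t) x = nbrSum G s x + nbrSum G t x := by
  simp [nbrSum, Finset.sum_add_distrib]

theorem adjForm_add (s t : V → ℝ) (h : ∀ x y, t x ≠ 0 → t y ≠ 0 → ¬ G.Adj x y) :
    adjForm G (s + t) = adjForm G s + 2 * ∑ x, t x * nbrSum G s x := by
  have h0 : ∑ x, t x * nbrSum G t x = 0 := by
    refine Finset.sum_eq_zero fun x _ => ?_
    by_cases hx : t x = 0
    · rw [hx, zero_mul]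
    · rw [nbrSum, Finset.sum_eq_zero, mul_zero]
      intro y hy
      by_contra hty
      exact h x y hx hty (by simpa using hy)
  have h1 := sum_mul_nbrSum_comm G s t
  simp only [adjForm, nbrSum_add, Pi.add_apply, add_mul, mul_add, Finset.sum_add_distrib]
  rw [h0, h1]
  ring

open scoped Classical in
/-- Reverse the spin of every vertex of `I` that has too many neighbours of the unwanted spin. -/
noncomputable def improve (ε : ℝ) (I : Finset V) (s : V → ℝ) (x : V) : ℝ :=
  if x ∈ I ∧ ε * s x * nbrSum G s x ≤ -1 then - s x else s x

-- Independence of I removes the interaction between reversed spins, so the gains add. Reversing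
-- s(x) changes ε times the form by −4·ε·s(x)·`nbrSum G s x`, which is at least 4 under the reversal
-- criterion.
open scoped Classical in
theorem adjForm_improve (ε : ℝ) (I : Finset V) (hI : ∀ x ∈ I, ∀ y ∈ I, ¬ G.Adj x y) (s : V → ℝ) :
    ε * adjForm G s + 4 * ∑ x ∈ I, (if ε * s x * nbrSum G s x ≤ -1 then 1 else 0) ≤
      ε * adjForm G (improve G ε I s) := by
  set t : V → ℝ := fun x => if x ∈ I ∧ ε * s x * nbrSum G s x ≤ -1 then -2 * s x else 0 with ht
  have h1 : improve G ε I s = s + t := by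
    ext x
    simp only [improve, Pi.add_apply, ht]
    split_ifs <;> ring
  rw [h1, adjForm_add]
  · rw [mul_add, add_le_add_iff_left, Finset.mul_sum, mul_left_comm, Finset.mul_sum, Finset.mul_sum,
      ← Finset.sum_subset (Finset.subset_univ I)]
    · refine Finset.sum_le_sum fun x hx => ?_
      simp only [ht, hx, true_and]
      split_ifs with h
      · linarith
      · simp
    · intro x _ hx
      simp [ht, hx]
  · intro x y hx hy
    simp only [ht, ne_eq, ite_eq_right_iff, Classical.not_imp] at hx hy
    exact hI x hx.1.1 y hy.1.1

theorem abs_nbrSum_le {s : V → ℝ} (hs : ∀ x, |s x| ≤ 1) (x : V) :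
    |nbrSum G s x| ≤ Nat.card (G.neighborSet x) := by
  classical
  rw [nbrSum]
  refine (Finset.abs_sum_le_sum_abs _ _).trans ((Finset.sum_le_sum fun y _ => hs y).trans ?_)
  rw [Finset.sum_const, nsmul_eq_mul, mul_one, SimpleGraph.card_neighborFinset_eq_degree,
    Nat.card_eq_fintype_card, SimpleGraph.card_neighborSet_eq_degree]

theorem adjForm_flip_le (S S' : Finset V) (x : V) (h : ∀ y, y ≠ x → (y ∈ S' ↔ y ∈ S)) :
    |adjForm G (spin S') - adjForm G (spin S)| ≤ 4 * Nat.card (G.neighborSet x) := by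
  classical
  have h0 : ∀ y, y ≠ x → (spin S' - spin S) y = 0 := by
    intro y hy
    simp [spin, h y hy]
  have h1 := adjForm_add G (spin S) (spin S' - spin S) (by
    intro y z hy hz
    have hy' : y = x := by by_contra hc; exact hy (h0 y hc)
    have hz' : z = x := by by_contra hc; exact hz (h0 z hc)
    rw [hy', hz']
    exact G.loopless.irrefl x)
  rw [add_sub_cancel, Finset.sum_eq_single x (fun y _ hy => by rw [h0 y hy, zero_mul])
    (by simp)] at h1
  rw [h1, add_sub_cancel_left, abs_mul, abs_mul]
  have h2 : |(spin S' - spin S) x| ≤ 2 := by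
    have := abs_sub (spin S' x) (spin S x)
    rw [abs_spin, abs_spin] at this
    simp only [Pi.sub_apply]
    linarith
  have h3 := abs_nbrSum_le G (s := spin S) (fun y => (abs_spin S y).le) x
  calc |(2 : ℝ)| * (|(spin S' - spin S) x| * |nbrSum G (spin S) x|)
      ≤ 2 * (2 * Nat.card (G.neighborSet x)) := by
        rw [abs_two]; gcongr
    _ = _ := by ring

/-- A spin configuration can be balanced by reversing spins at vertices of degree at most `d`. -/
theorem exists_bisection_adjForm (d : ℕ) (A : Finset V)
    (hA : ∀ x ∈ A, Nat.card (G.neighborSet x) ≤ d) (hcard : Fintype.card V ≤ 2 * A.card)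
    (m : ℕ) : ∀ S : Finset V, (2 * (S.card : ℤ) - Fintype.card V).natAbs = m →
      ∃ S' : Finset V, |2 * (S'.card : ℤ) - Fintype.card V| ≤ 1 ∧
        |adjForm G (spin S') - adjForm G (spin S)| ≤ 2 * d * m := by
  classical
  induction m using Nat.strong_induction_on with
  | _ m ih =>
  intro S hS
  by_cases hm : m ≤ 1
  · refine ⟨S, by rw [Int.abs_eq_natAbs, hS]; exact_mod_cast hm, ?_⟩
    rw [sub_self, abs_zero]
    positivity
  -- One reversal lowers the imbalance by 2 and moves the form by at most 4d, which gives the rate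
  -- 2d per unit of imbalance. The larger side always meets A, because A contains at least half of
  -- the vertices.
  have step : ∀ (x : V) (S₁ : Finset V), x ∈ A → (∀ y, y ≠ x → (y ∈ S₁ ↔ y ∈ S)) →
      (2 * (S₁.card : ℤ) - Fintype.card V).natAbs = m - 2 →
      ∃ S' : Finset V, |2 * (S'.card : ℤ) - Fintype.card V| ≤ 1 ∧
        |adjForm G (spin S') - adjForm G (spin S)| ≤ 2 * d * m := by
    intro x S₁ hx h1 h2
    obtain ⟨S', hb, hS'⟩ := ih (m - 2) (by omega) S₁ h2
    refine ⟨S', hb, ?_⟩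
    have h3 := adjForm_flip_le G S S₁ x h1
    have h4 := abs_sub_le (adjForm G (spin S')) (adjForm G (spin S₁)) (adjForm G (spin S))
    have h5 : ((Nat.card (G.neighborSet x) : ℕ) : ℝ) ≤ d := by exact_mod_cast hA x hx
    rw [Nat.cast_sub (by omega)] at hS'
    push_cast at hS'
    nlinarith
  have hc := Finset.card_add_card_compl S
  rcases le_total (Fintype.card V : ℤ) (2 * S.card) with h | h
  · have : (S ∩ A).Nonempty := by
      by_contra hne
      rw [Finset.not_nonempty_iff_eq_empty, ← Finset.disjoint_iff_inter_eq_empty] at hne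
      have h1 := Finset.card_union_of_disjoint hne
      have h2 := Finset.card_le_univ (S ∪ A)
      omega
    obtain ⟨x, hx⟩ := this
    rw [Finset.mem_inter] at hx
    refine step x (S.erase x) hx.2 (fun y hy => by simp [hy]) ?_
    have h1 := Finset.card_erase_of_mem hx.1
    have h2 := Finset.card_pos.2 ⟨x, hx.1⟩
    omega
  · have : (Sᶜ ∩ A).Nonempty := by
      by_contra hne
      rw [Finset.not_nonempty_iff_eq_empty, ← Finset.disjoint_iff_inter_eq_empty] at hne
      have h1 := Finset.card_union_of_disjoint hne
      have h2 := Finset.card_le_univ (Sᶜ ∪ A)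
      omega
    obtain ⟨x, hx⟩ := this
    rw [Finset.mem_inter, Finset.mem_compl] at hx
    refine step x (insert x S) hx.2 (fun y hy => by simp [hy]) ?_
    have h1 := Finset.card_insert_of_notMem hx.1
    omega

theorem isBisection_iff (S : Finset V) :
    IsBisection S ↔ |2 * (S.card : ℤ) - Fintype.card V| ≤ 1 := by
  classical
  have h := Finset.card_add_card_compl S
  have e : (S.card : ℤ) - (Sᶜ.card : ℤ) = 2 * (S.card : ℤ) - Fintype.card V := by omega
  rw [← e, IsBisection]

-- An edge of the cut occurs as two ordered pairs, each with 1 − s(x)s(y) = 2; all other edges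
-- contribute 0.
open scoped Classical in
theorem cutSize_eq (S : Finset V) :
    (cutSize G S : ℝ) = (∑ x, (G.degree x : ℝ) - adjForm G (spin S)) / 4 := by
  have h1 : (cutSize G S : ℝ) = ∑ x, ∑ y, if x ∈ S ∧ y ∉ S ∧ G.Adj x y then 1 else 0 := by
    rw [cutSize, SimpleGraph.interedges, Rel.interedges, Finset.card_filter, Finset.sum_product]
    push_cast
    rw [← Finset.sum_subset (Finset.subset_univ S)
      (fun x _ hx => Finset.sum_eq_zero fun y _ => by simp [hx])]
    refine Finset.sum_congr rfl fun x hx => ?_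
    rw [← Finset.sum_subset (Finset.subset_univ Sᶜ)
      (fun y _ hy => by rw [if_neg]; simp at hy; simp [hy])]
    refine Finset.sum_congr rfl fun y hy => ?_
    rw [Finset.mem_compl] at hy
    simp [hx, hy]
  have h2 : (cutSize G S : ℝ) = ∑ x, ∑ y, if y ∈ S ∧ x ∉ S ∧ G.Adj x y then 1 else 0 := by
    rw [h1, Finset.sum_comm]
    simp only [G.adj_comm]
  have h3 : ∑ x, (G.degree x : ℝ) - adjForm G (spin S) =
      ∑ x, ∑ y, (2 * (if x ∈ S ∧ y ∉ S ∧ G.Adj x y then 1 else 0) +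
        2 * (if y ∈ S ∧ x ∉ S ∧ G.Adj x y then 1 else 0) : ℝ) := by
    rw [adjForm, ← Finset.sum_sub_distrib]
    refine Finset.sum_congr rfl fun x _ => ?_
    have : (G.degree x : ℝ) = nbrSum G (fun _ => 1) x := by simp [nbrSum]
    rw [this, nbrSum_eq, nbrSum_eq, Finset.mul_sum, ← Finset.sum_sub_distrib]
    refine Finset.sum_congr rfl fun y _ => ?_
    by_cases hx : x ∈ S <;> by_cases hy : y ∈ S <;> by_cases ha : G.Adj x y <;>
      simp [hx, hy, ha, spin] <;> norm_num
  simp only [Finset.sum_add_distrib, ← Finset.mul_sum] at h3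
  rw [h3, ← h1, ← h2]
  ring

theorem sum_spin (S : Finset V) : ∑ x, spin S x = 2 * S.card - Fintype.card V := by
  classical
  have : ∀ x, spin S x = 2 * (if x ∈ S then 1 else 0) - 1 := fun x => by
    unfold spin
    split_ifs <;> norm_num
  simp [this, Finset.sum_sub_distrib, mul_comm]

theorem exists_mem_bisections_adjForm (d : ℕ) (A : Finset V)
    (hA : ∀ x ∈ A, Nat.card (G.neighborSet x) ≤ d) (hcard : Fintype.card V ≤ 2 * A.card)
    {ε : ℝ} (hε : |ε| = 1) (S : Finset V) : ∃ S' ∈ bisections V,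
      ε * adjForm G (spin S) - 2 * d * |∑ x, spin S x| ≤ ε * adjForm G (spin S') := by
  obtain ⟨S', h1, h2⟩ := exists_bisection_adjForm G d A hA hcard _ S rfl
  refine ⟨S', by simpa [bisections] using (isBisection_iff S').2 h1, ?_⟩
  rw [Nat.cast_natAbs] at h2
  have h3 : |ε * (adjForm G (spin S') - adjForm G (spin S))| ≤ 2 * d * |∑ x, spin S x| := by
    rw [abs_mul, hε, one_mul, sum_spin]
    exact_mod_cast h2
  have := (abs_le.1 h3).1
  linarith

end CutForm

open Matrix

/-! ### The improved sign field: symmetry, locality and fluctuation of its sum -/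

section Field

variable {V : Type*} [Fintype V] (G : SimpleGraph V) (β : ℝ) (R : ℕ)

/-- The signs of the linear factor with wave coefficients. -/
noncomputable def signField (g : V → ℝ) (x : V) : ℝ := Real.sign (wave G β R x ⬝ᵥ g)

theorem measurable_signField (x : V) : Measurable fun g => signField G β R g x :=
  measurable_sign_real.comp (measurable_dotProduct_label _)

theorem abs_signField_le (g : V → ℝ) (x : V) : |signField G β R g x| ≤ 1 := abs_sign_le_one _

theorem measurable_nbrSum_signField (x : V) :
    Measurable fun g => nbrSum G (signField G β R g) x := by
  classical
  unfold nbrSum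
  exact Finset.measurable_fun_sum _ fun y _ => measurable_signField G β R y

theorem measurableSet_flip (ε : ℝ) (x : V) : MeasurableSet
    {g | ε * signField G β R g x * nbrSum G (signField G β R g) x ≤ -1} :=
  measurableSet_le ((measurable_const.mul (measurable_signField G β R x)).mul
    (measurable_nbrSum_signField G β R x)) measurable_const

theorem measurable_improve (ε : ℝ) (I : Finset V) (x : V) :
    Measurable fun g => improve G ε I (signField G β R g) x := by
  classical
  unfold improve
  by_cases hx : x ∈ I
  · simp only [hx, true_and]
    exact Measurable.ite (measurableSet_flip G β R ε x) (measurable_signField G β R x).neg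
      (measurable_signField G β R x)
  · simp only [hx, false_and, if_false]
    exact measurable_signField G β R x

theorem abs_improve (ε : ℝ) (I : Finset V) (s : V → ℝ) (x : V) : |improve G ε I s x| = |s x| := by
  unfold improve
  split_ifs
  · exact abs_neg _
  · rfl

theorem signField_neg (g : V → ℝ) : signField G β R (-g) = - signField G β R g := by
  ext x
  simp [signField, Real.sign_neg]

theorem nbrSum_neg (s : V → ℝ) (x : V) : nbrSum G (-s) x = - nbrSum G s x := by
  simp [nbrSum]

theorem improve_neg (ε : ℝ) (I : Finset V) (s : V → ℝ) :
    improve G ε I (-s) = - improve G ε I s := by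
  ext x
  have e : ε * (-s) x * nbrSum G (-s) x = ε * s x * nbrSum G s x := by
    rw [nbrSum_neg, Pi.neg_apply]
    ring
  by_cases h : x ∈ I ∧ ε * s x * nbrSum G s x ≤ -1
  · rw [Pi.neg_apply, improve, improve, if_pos h, if_pos (by rwa [e]), Pi.neg_apply]
  · rw [Pi.neg_apply, improve, improve, if_neg h, if_neg (by rwa [e]), Pi.neg_apply]

/-- The law of the labels is invariant under g ↦ −g, and the improvement rule is odd. -/
theorem integral_improve_eq_zero (ε : ℝ) (I : Finset V) (x : V) :
    ∫ g, improve G ε I (signField G β R g) x ∂(labelLaw V) = 0 := by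
  have hinv : (labelLaw V).IsNegInvariant := by
    have : (gaussianReal 0 1).IsNegInvariant := ⟨by
      have := gaussianReal_map_neg (μ := 0) (v := 1)
      rw [neg_zero] at this
      exact this⟩
    unfold labelLaw
    infer_instance
  have h1 := integral_neg_eq_self (fun g => improve G ε I (signField G β R g) x) (labelLaw V)
  simp only [signField_neg, improve_neg, Pi.neg_apply, integral_neg] at h1
  linarith

theorem improve_congr (ε : ℝ) (I : Finset V) (s s' : V → ℝ) (x : V) (hx : s x = s' x)
    (hn : ∀ y, G.Adj x y → s y = s' y) : improve G ε I s x = improve G ε I s' x := by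
  classical
  have : nbrSum G s x = nbrSum G s' x := by
    rw [nbrSum, nbrSum]
    exact Finset.sum_congr rfl fun y hy => hn y (by simpa using hy)
  rw [improve, improve, hx, this]

open scoped Classical in
/-- The ball of radius `n` around `x` as a finset. -/
noncomputable def ballFinset (n : ℕ) (x : V) : Finset V := Finset.univ.filter fun z => G.edist x z ≤ n

theorem mem_ballFinset {n : ℕ} {x z : V} : z ∈ ballFinset G n x ↔ G.edist x z ≤ n := by
  simp [ballFinset]

open scoped Classical in
/-- Extension by zero from a set of labels. -/
noncomputable def extendZero (T : Finset V) (h : T → ℝ) (z : V) : ℝ :=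
  if hz : z ∈ T then h ⟨z, hz⟩ else 0

theorem measurable_extendZero {W : Type*} (T : Finset W) : Measurable (extendZero T) := by
  classical
  refine measurable_pi_lambda _ fun z => ?_
  unfold extendZero
  split_ifs with hz
  · exact measurable_pi_apply _
  · exact measurable_const

theorem dotProduct_extendZero (T : Finset V) (u g : V → ℝ) (hu : ∀ z, u z ≠ 0 → z ∈ T) :
    u ⬝ᵥ g = u ⬝ᵥ extendZero T fun i => g i := by
  refine Finset.sum_congr rfl fun z _ => ?_
  by_cases hz : u z = 0
  · rw [hz, zero_mul, zero_mul]
  · rw [extendZero, dif_pos (hu z hz)]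

/-- The improved spin at x reads only labels within distance R + 1: R for a wave, and one more step
for the neighbours consulted by the rule. -/
theorem improve_signField_extendZero (ε : ℝ) (I : Finset V) (x : V) (g : V → ℝ) :
    improve G ε I (signField G β R g) x = improve G ε I
      (signField G β R (extendZero (ballFinset G (R + 1) x) fun i => g i)) x := by
  refine improve_congr G ε I _ _ x ?_ fun y hy => ?_
  · rw [signField, dotProduct_extendZero (ballFinset G (R + 1) x), ← signField]
    intro z hz
    rw [mem_ballFinset]
    exact (edist_le_of_wave_ne_zero hz).trans (by exact_mod_cast R.le_succ)
  · rw [signField, dotProduct_extendZero (ballFinset G (R + 1) x), ← signField]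
    intro z hz
    rw [mem_ballFinset]
    exact edist_le_of_wave_nbr_ne_zero hy hz

theorem indepFun_improve (ε : ℝ) (I : Finset V) (x y : V)
    (hxy : Disjoint (ballFinset G (R + 1) x) (ballFinset G (R + 1) y)) :
    IndepFun (fun g => improve G ε I (signField G β R g) x)
      (fun g => improve G ε I (signField G β R g) y) (labelLaw V) := by
  have h1 : iIndepFun (fun (i : V) (g : V → ℝ) => g i) (labelLaw V) :=
    iIndepFun_pi (X := fun (_ : V) (t : ℝ) => t) fun _ => by fun_prop
  have h2 := h1.indepFun_finset _ _ hxy fun i => measurable_pi_apply i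
  have h3 : ∀ x, Measurable fun h : ballFinset G (R + 1) x → ℝ =>
      improve G ε I (signField G β R (extendZero _ h)) x := fun x =>
    (measurable_improve G β R ε I x).comp (measurable_extendZero _)
  have h4 := h2.comp (h3 x) (h3 y)
  have e := fun x => funext (improve_signField_extendZero G β R ε I x)
  rw [e x, e y]
  exact h4

theorem integrable_of_abs_le {f : (V → ℝ) → ℝ} (hf : Measurable f) {c : ℝ} (hc : ∀ g, |f g| ≤ c) :
    Integrable f (labelLaw V) :=
  Integrable.of_bound hf.aestronglyMeasurable c (ae_of_all _ hc)

/-- At such distances the two balls of radius R + 1 are disjoint, so the spins are independent and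
centred. -/
theorem integral_improve_mul (ε : ℝ) (I : Finset V) (x y : V)
    (hxy : ¬ G.edist x y ≤ (2 * R + 3 : ℕ)) :
    ∫ g, improve G ε I (signField G β R g) x * improve G ε I (signField G β R g) y
      ∂(labelLaw V) = 0 := by
  have hd : Disjoint (ballFinset G (R + 1) x) (ballFinset G (R + 1) y) := by
    rw [Finset.disjoint_left]
    intro z hz hz'
    rw [mem_ballFinset] at hz hz'
    refine hxy (G.edist_triangle.trans ((add_le_add hz (G.edist_comm.trans_le hz')).trans ?_))
    norm_cast
    omega
  have := (indepFun_improve G β R ε I x y hd).integral_mul_eq_mul_integral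
    (measurable_improve G β R ε I x).aestronglyMeasurable
    (measurable_improve G β R ε I y).aestronglyMeasurable
  rw [integral_improve_eq_zero, zero_mul] at this
  exact this

/-- Each spin in A correlates with at most C others, counting itself, so the sum over A has second
moment at most N·C, where N is the number of vertices. The parameter a converts this into a first
moment bound through |t| ≤ (t²/a + a)/2; vertices outside A are counted trivially. -/
theorem integral_abs_sum_improve_le (ε : ℝ) (I A : Finset V) (C : ℕ) {a : ℝ} (ha : 0 < a)
    (hC : ∀ x ∈ A, Nat.card (graphBall G x (2 * R + 3)) ≤ C) :
    ∫ g, |∑ x, improve G ε I (signField G β R g) x| ∂(labelLaw V) ≤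
      (Fintype.card V - A.card : ℝ) + (Fintype.card V * C / a + a) / 2 := by
  classical
  set s' : (V → ℝ) → V → ℝ := fun g => improve G ε I (signField G β R g) with hs'
  have hmeas : ∀ x, Measurable fun g => s' g x := measurable_improve G β R ε I
  have habs : ∀ g x, |s' g x| ≤ 1 := fun g x => by
    rw [hs', abs_improve]; exact abs_signField_le G β R g x
  have hmul : ∀ x y, ∀ g, |s' g x * s' g y| ≤ 1 := fun x y g => by
    rw [abs_mul]
    exact mul_le_one₀ (habs g x) (abs_nonneg _) (habs g y)
  have hint : ∀ x y, Integrable (fun g => s' g x * s' g y) (labelLaw V) := fun x y =>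
    integrable_of_abs_le ((hmeas x).mul (hmeas y)) (hmul x y)
  have h1 : ∫ g, (∑ x ∈ A, s' g x) ^ 2 ∂(labelLaw V) ≤ Fintype.card V * C := by
    have e : ∀ g, (∑ x ∈ A, s' g x) ^ 2 = ∑ x ∈ A, ∑ y ∈ A, s' g x * s' g y := fun g => by
      rw [sq, Finset.sum_mul_sum]
    simp_rw [e]
    rw [integral_finsetSum _ fun x _ => integrable_finsetSum _ fun y _ => hint x y]
    have h2 : ∀ x ∈ A, ∫ g, ∑ y ∈ A, s' g x * s' g y ∂(labelLaw V) ≤ C := by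
      intro x hx
      rw [integral_finsetSum _ fun y _ => hint x y]
      calc ∑ y ∈ A, ∫ g, s' g x * s' g y ∂(labelLaw V)
          ≤ ∑ y ∈ A, if y ∈ ballFinset G (2 * R + 3) x then 1 else 0 := by
            refine Finset.sum_le_sum fun y _ => ?_
            split_ifs with hy
            · calc _ ≤ ∫ _, (1 : ℝ) ∂(labelLaw V) :=
                    integral_mono (hint x y) (integrable_const _)
                      fun g => (le_abs_self _).trans (hmul x y g)
                _ = 1 := by simp
            · rw [mem_ballFinset] at hy
              exact (integral_improve_mul G β R ε I x y hy).le
        _ ≤ ∑ y, if y ∈ ballFinset G (2 * R + 3) x then 1 else 0 :=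
            Finset.sum_le_sum_of_subset_of_nonneg (Finset.subset_univ _)
              fun y _ _ => by split_ifs <;> norm_num
        _ = (ballFinset G (2 * R + 3) x).card := by simp
        _ ≤ C := by
            have h3 := hC x hx
            rw [Nat.card_eq_fintype_card, ← Set.toFinset_card] at h3
            refine le_trans ?_ (Nat.cast_le.2 h3)
            rw [Nat.cast_le]
            refine Finset.card_le_card fun z hz => ?_
            rw [Set.mem_toFinset, mem_graphBall]
            exact (mem_ballFinset G).1 hz
    refine (Finset.sum_le_sum h2).trans ?_
    rw [Finset.sum_const, nsmul_eq_mul]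
    gcongr
    exact Finset.card_le_univ A
  have hcardA : ∀ g, |∑ x ∈ A, s' g x| ≤ A.card := fun g =>
    (Finset.abs_sum_le_sum_abs _ _).trans ((Finset.sum_le_sum fun x _ => habs g x).trans (by simp))
  have h2 : ∀ g, |∑ x, s' g x| ≤
      (Fintype.card V - A.card : ℝ) + ((∑ x ∈ A, s' g x) ^ 2 / a + a) / 2 := by
    intro g
    rw [← Finset.sum_add_sum_compl A]
    have h3 : |∑ x ∈ Aᶜ, s' g x| ≤ (Fintype.card V - A.card : ℝ) := by
      refine (Finset.abs_sum_le_sum_abs _ _).trans ((Finset.sum_le_sum fun x _ => habs g x).trans ?_)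
      rw [Finset.sum_const, nsmul_eq_mul, mul_one, Finset.card_compl,
        Nat.cast_sub (Finset.card_le_univ A)]
    have h4 : |∑ x ∈ A, s' g x| ≤ ((∑ x ∈ A, s' g x) ^ 2 / a + a) / 2 := by
      rw [← sq_abs (∑ x ∈ A, s' g x)]
      set b := |∑ x ∈ A, s' g x|
      have : b ^ 2 / a + a - 2 * b = (b - a) ^ 2 / a := by field_simp; ring
      have := div_nonneg (sq_nonneg (b - a)) ha.le
      linarith
    exact (abs_add_le _ _).trans (by linarith)
  have hsq : Integrable (fun g => (∑ x ∈ A, s' g x) ^ 2) (labelLaw V) :=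
    integrable_of_abs_le ((Finset.measurable_fun_sum _ fun x _ => hmeas x).pow_const 2)
      (c := (A.card : ℝ) ^ 2) fun g => by
        rw [abs_pow]
        exact pow_le_pow_left₀ (abs_nonneg _) (hcardA g) 2
  have hb : Integrable (fun g => ((∑ x ∈ A, s' g x) ^ 2 / a + a) / 2) (labelLaw V) :=
    ((hsq.div_const a).add (integrable_const a)).div_const 2
  calc _ ≤ ∫ g, ((Fintype.card V - A.card : ℝ) + ((∑ x ∈ A, s' g x) ^ 2 / a + a) / 2)
        ∂(labelLaw V) := by
        refine integral_mono (integrable_of_abs_le (c := Fintype.card V)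
          (Finset.measurable_fun_sum _ fun x _ => hmeas x).abs fun g => ?_) ?_ h2
        · rw [abs_abs]
          refine (Finset.abs_sum_le_sum_abs _ _).trans
            ((Finset.sum_le_sum fun x _ => habs g x).trans (by simp))
        · exact (integrable_const _).add hb
    _ ≤ _ := by
        rw [integral_add (integrable_const _) hb, integral_div,
          integral_add (hsq.div_const a) (integrable_const a), integral_div]
        simp only [integral_const, probReal_univ, one_smul]
        gcongr

end Field

/-! ### Expected quadratic form and choice of a good labelling -/

section Expectation

variable {V : Type*} [Fintype V] {G : SimpleGraph V} {d R : ℕ} {x : V} {q b ε : ℝ}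

/-- The common squared length of the waves centred in a tree-like region. -/
noncomputable def waveNorm (R : ℕ) (b : ℝ) : ℝ := 1 + R + R * b ^ 2

theorem waveNorm_pos (R : ℕ) (b : ℝ) : 0 < waveNorm R b := by
  unfold waveNorm
  positivity

theorem two_mul_lt_waveNorm (R : ℕ) (b : ℝ) : 2 * R * b < waveNorm R b := by
  unfold waveNorm
  have : (0 : ℝ) ≤ R * (1 - b) ^ 2 := by positivity
  nlinarith

theorem IsTreeLike.integral_sign_nbr (h : IsTreeLike G d x (2 * R + 3)) (hd : (d : ℝ) = q + 1)
    (hq : 0 < q) (hb : b ^ 2 * q = 1) (hb0 : 0 < b) (hε : ε = 1 ∨ ε = -1) (hR : 1 ≤ R) {y : V}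
    (hy : G.Adj x y) :
    ∫ g, ε * (signField G (ε * b) R g x * signField G (ε * b) R g y) ∂(labelLaw V) =
      1 - 2 * Real.arccos (2 * R * b / waveNorm R b) / Real.pi := by
  have hε2 : ε ^ 2 = 1 := by rcases hε with rfl | rfl <;> norm_num
  have hβ : (ε * b) ^ 2 * q = 1 := by rw [mul_pow, hε2, one_mul, hb]
  have hN : 1 + R + R * (ε * b) ^ 2 = waveNorm R b := by rw [mul_pow, hε2, one_mul, waveNorm]
  have hxx := h.wave_self (R := R) (by omega) hd hq hβ
  have hyy := h.wave_nbr_self (R := R) (by omega) hd hq hβ hR hy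
  have hxy := h.wave_center_nbr (R := R) (by omega) hd hq hβ hR hy
  rw [hN] at hxx hyy
  have hlt := two_mul_lt_waveNorm R b
  have h0 : 0 ≤ 2 * R * b := by positivity
  have hpos := waveNorm_pos R b
  rw [integral_const_mul]
  unfold signField
  rcases hε with rfl | rfl
  · rw [label_sign_corr hpos hxx hyy (by rw [hxy]; linarith) (by rw [hxy]; linarith), hxy]
    simp
  · rw [label_sign_corr hpos hxx hyy (by rw [hxy]; linarith) (by rw [hxy]; linarith), hxy,
      show 2 * R * (-1 * b) / waveNorm R b = -(2 * R * b / waveNorm R b) by ring, Real.arccos_neg]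
    have := Real.pi_ne_zero
    field_simp
    ring

theorem integrable_sign_nbrSum (G : SimpleGraph V) (β : ℝ) (R : ℕ) (x : V) : Integrable
    (fun g => signField G β R g x * nbrSum G (signField G β R g) x) (labelLaw V) :=
  integrable_of_abs_le ((measurable_signField G β R x).mul (measurable_nbrSum_signField G β R x))
    (c := Nat.card (G.neighborSet x)) fun g => by
      rw [abs_mul]
      have h1 := abs_nbrSum_le G (abs_signField_le G β R g) x
      have h2 := abs_signField_le G β R g x
      nlinarith [abs_nonneg (signField G β R g x), abs_nonneg (nbrSum G (signField G β R g) x)]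

theorem IsTreeLike.card_neighborSet {V : Type*} {G : SimpleGraph V} {x : V} (h : IsTreeLike G d x (2 * R + 3)) :
    Nat.card (G.neighborSet x) = d := h.card_nbr 0 x (by omega) (by simp)

theorem IsTreeLike.integral_sign_nbrSum (h : IsTreeLike G d x (2 * R + 3)) (hd : (d : ℝ) = q + 1)
    (hq : 0 < q) (hb : b ^ 2 * q = 1) (hb0 : 0 < b) (hε : ε = 1 ∨ ε = -1) (hR : 1 ≤ R) :
    ∫ g, ε * (signField G (ε * b) R g x * nbrSum G (signField G (ε * b) R g) x) ∂(labelLaw V) =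
      d * (1 - 2 * Real.arccos (2 * R * b / waveNorm R b) / Real.pi) := by
  classical
  simp only [nbrSum, Finset.mul_sum]
  rw [integral_finsetSum]
  · rw [Finset.sum_congr rfl fun y hy =>
      h.integral_sign_nbr hd hq hb hb0 hε hR (by simpa using hy), Finset.sum_const,
      h.degree_eq (k := 0) (by omega) (by simp), nsmul_eq_mul]
  · intro y _
    refine integrable_of_abs_le (c := |ε|) (measurable_const.mul
      ((measurable_signField G _ R x).mul (measurable_signField G _ R y))) fun g => ?_
    rw [abs_mul, abs_mul]
    have h1 := abs_signField_le G (ε * b) R g x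
    have h2 := abs_signField_le G (ε * b) R g y
    exact mul_le_of_le_one_right (abs_nonneg _) (mul_le_one₀ h1 (abs_nonneg _) h2)

/-- A vertex outside A contributes at least minus its degree. The total loss is the degree sum minus
d|A|, which is o(N) exactly because the average degree tends to d. -/
theorem integral_adjForm_ge (A : Finset V) (hA : ∀ x ∈ A, IsTreeLike G d x (2 * R + 3))
    (hd : (d : ℝ) = q + 1) (hq : 0 < q) (hb : b ^ 2 * q = 1) (hb0 : 0 < b)
    (hε : ε = 1 ∨ ε = -1) (hR : 1 ≤ R) :
    A.card * (d * (1 - 2 * Real.arccos (2 * R * b / waveNorm R b) / Real.pi)) -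
      ((∑ x, (Nat.card (G.neighborSet x) : ℝ)) - A.card * d) ≤
      ∫ g, ε * adjForm G (signField G (ε * b) R g) ∂(labelLaw V) := by
  classical
  have hint := integrable_sign_nbrSum G (ε * b) R
  simp only [adjForm, Finset.mul_sum]
  rw [integral_finsetSum _ fun x _ => (hint x).const_mul ε, ← Finset.sum_add_sum_compl A
    (fun x => ∫ g, ε * (signField G (ε * b) R g x * nbrSum G (signField G (ε * b) R g) x)
      ∂(labelLaw V)), Finset.sum_congr rfl fun x hx => (hA x hx).integral_sign_nbrSum hd hq hb hb0 hε hR,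
    Finset.sum_const, nsmul_eq_mul, ← Finset.sum_add_sum_compl A (fun x =>
      (Nat.card (G.neighborSet x) : ℝ)),
    Finset.sum_congr (g := fun _ => (d : ℝ)) rfl fun x hx => by rw [(hA x hx).card_neighborSet],
    Finset.sum_const, nsmul_eq_mul, add_sub_cancel_left, sub_eq_add_neg, add_le_add_iff_left,
    ← Finset.sum_neg_distrib]
  refine Finset.sum_le_sum fun x _ => ?_
  have : ∫ _, -(Nat.card (G.neighborSet x) : ℝ) ∂(labelLaw V) = -(Nat.card (G.neighborSet x) : ℝ) := by
    simp
  rw [← this]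
  refine integral_mono (integrable_const _) ((hint x).const_mul ε) fun g => ?_
  have h1 := abs_nbrSum_le G (abs_signField_le G (ε * b) R g) x
  have h2 := abs_signField_le G (ε * b) R g x
  have h3 : |ε * (signField G (ε * b) R g x * nbrSum G (signField G (ε * b) R g) x)| ≤
      Nat.card (G.neighborSet x) := by
    rw [abs_mul, abs_mul, show |ε| = 1 by rcases hε with rfl | rfl <;> simp, one_mul]
    nlinarith [abs_nonneg (signField G (ε * b) R g x),
      abs_nonneg (nbrSum G (signField G (ε * b) R g) x)]
  exact (abs_le.1 h3).1

/-- The expected form after improving the sign field on an independent set and rebalancing. -/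
theorem exists_bisection_ge (A I : Finset V) (hIA : I ⊆ A) (hI : ∀ x ∈ I, ∀ y ∈ I, ¬ G.Adj x y)
    (hA : ∀ x ∈ A, IsTreeLike G d x (2 * R + 3)) (C : ℕ)
    (hC : ∀ x ∈ A, Nat.card (graphBall G x (2 * R + 3)) ≤ C)
    (hcard : Fintype.card V ≤ 2 * A.card)
    (hd : (d : ℝ) = q + 1) (hq : 0 < q) (hb : b ^ 2 * q = 1) (hb0 : 0 < b)
    (hε : ε = 1 ∨ ε = -1) (hR : 1 ≤ R) {c a : ℝ} (ha : 0 < a)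
    (hc : ∀ x ∈ A, c ≤ (labelLaw V).real {g | ε * signField G (ε * b) R g x *
      nbrSum G (signField G (ε * b) R g) x ≤ -1}) :
    ∃ S ∈ bisections V,
      A.card * (d * (1 - 2 * Real.arccos (2 * R * b / waveNorm R b) / Real.pi)) -
      ((∑ x, (Nat.card (G.neighborSet x) : ℝ)) - A.card * d) + 4 * (I.card * c) -
      2 * d * ((Fintype.card V - A.card : ℝ) + (Fintype.card V * C / a + a) / 2) ≤
      ε * adjForm G (spin S) := by
  classical
  set s : (V → ℝ) → V → ℝ := signField G (ε * b) R with hs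
  set s' : (V → ℝ) → V → ℝ := fun g => improve G ε I (s g) with hs'
  set E : V → Set (V → ℝ) := fun x => {g | ε * s g x * nbrSum G (s g) x ≤ -1} with hE
  have hEm : ∀ x, MeasurableSet (E x) := measurableSet_flip G (ε * b) R ε
  have hintE : Integrable (fun g => ∑ x ∈ I, (E x).indicator (1 : (V → ℝ) → ℝ) g) (labelLaw V) :=
    integrable_finsetSum _ fun x _ => (integrable_const (1 : ℝ)).indicator (hEm x)
  have hintF : Integrable (fun g => ε * adjForm G (s g)) (labelLaw V) :=
    (integrable_finsetSum _ fun x _ => integrable_sign_nbrSum G (ε * b) R x).const_mul ε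
  have hintM : Integrable (fun g => |∑ x, s' g x|) (labelLaw V) :=
    integrable_of_abs_le (c := Fintype.card V)
      (Finset.measurable_fun_sum _ fun x _ => measurable_improve G (ε * b) R ε I x).abs fun g => by
        rw [abs_abs]
        refine (Finset.abs_sum_le_sum_abs _ _).trans
          ((Finset.sum_le_sum (g := fun _ => (1 : ℝ)) fun x _ => ?_).trans (by simp))
        rw [hs', abs_improve]
        exact abs_signField_le G (ε * b) R g x
  -- Off this null set no sign is 0, so the field is a genuine ±1 configuration.
  have hnull : ∀ᵐ g ∂(labelLaw V), ∀ x, wave G (ε * b) R x ⬝ᵥ g ≠ 0 := by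
    rw [ae_all_iff]
    intro x
    refine label_ae_ne_zero fun h => ?_
    have := congrFun h x
    rw [wave_center] at this
    simp at this
  -- First moment method: the gain and the cost of balancing are combined in one function, so that a
  -- single g serves both.
  obtain ⟨g, hg, hle⟩ := exists_notMem_null_integral_le
    (f := fun g => ε * adjForm G (s g) + 4 * (∑ x ∈ I, (E x).indicator (1 : (V → ℝ) → ℝ) g) -
      2 * d * |∑ x, s' g x|)
    ((hintF.add (hintE.const_mul 4)).sub (hintM.const_mul (2 * d))) (ae_iff.1 hnull)
  replace hg : ∀ x, wave G (ε * b) R x ⬝ᵥ g ≠ 0 := not_not.1 hg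
  have hs1 : ∀ x, s' g x = 1 ∨ s' g x = -1 := by
    intro x
    rw [← abs_eq zero_le_one, hs', abs_improve, hs, signField]
    rcases Real.sign_apply_eq_of_ne_zero _ (hg x) with h | h <;> simp [h]
  have hspin : spin (Finset.univ.filter fun x => s' g x = 1) = s' g := by
    ext x
    unfold spin
    rcases hs1 x with h | h <;> simp [h]
    norm_num
  have hd0 : (0 : ℝ) ≤ 2 * d := by positivity
  obtain ⟨S, hS, hS'⟩ := exists_mem_bisections_adjForm G d A
    (fun x hx => (hA x hx).card_neighborSet.le) hcard (ε := ε)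
    (by rcases hε with rfl | rfl <;> simp) (Finset.univ.filter fun x => s' g x = 1)
  refine ⟨S, hS, le_trans ?_ hS'⟩
  rw [hspin]
  have h1 := adjForm_improve G ε I hI (s g)
  have h2 : ∑ x ∈ I, (if ε * s g x * nbrSum G (s g) x ≤ -1 then (1 : ℝ) else 0) =
      ∑ x ∈ I, (E x).indicator (1 : (V → ℝ) → ℝ) g := by
    simp [Set.indicator, hE]
  rw [h2] at h1
  refine le_trans ?_ (hle.trans (sub_le_sub_right h1 _))
  have hFE : Integrable (fun g => ε * adjForm G (s g) +
      4 * ∑ x ∈ I, (E x).indicator (1 : (V → ℝ) → ℝ) g) (labelLaw V) :=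
    hintF.add (hintE.const_mul 4)
  rw [integral_sub hFE (hintM.const_mul (2 * d)),
    integral_add hintF (hintE.const_mul 4), integral_const_mul, integral_const_mul 4,
    integral_const_mul (2 * (d : ℝ)),
    integral_finsetSum (f := fun x g => (E x).indicator (1 : (V → ℝ) → ℝ) g) _
      fun x _ => (integrable_const (1 : ℝ)).indicator (hEm x)]
  have h3 := integral_adjForm_ge A hA hd hq hb hb0 hε hR
  rw [integral_const_mul] at h3
  have h4 : I.card * c ≤ ∑ x ∈ I, ∫ g, (E x).indicator (1 : (V → ℝ) → ℝ) g ∂(labelLaw V) := by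
    rw [← nsmul_eq_mul, ← Finset.sum_const]
    refine Finset.sum_le_sum fun x hx => ?_
    rw [integral_indicator_one (hEm x)]
    exact hc x (hIA hx)
  have h5 := mul_le_mul_of_nonneg_left
    (integral_abs_sum_improve_le G (ε * b) R ε I A C ha hC) hd0
  exact sub_le_sub (add_le_add h3 (mul_le_mul_of_nonneg_left h4 (by norm_num))) h5

end Expectation

/-! ### Positive probability of a profitable reversal -/

section Flip

variable {V : Type*} [Fintype V] {G : SimpleGraph V} {d R : ℕ} {x : V} {q b ε : ℝ}

/-- The inner product of the waves at two neighbours of a common vertex. -/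
noncomputable def waveNbr (q : ℝ) (R : ℕ) (b : ℝ) : ℝ :=
  b ^ 2 + 2 * (R - 1) * b ^ 2 + (q - 1) * (R - 1) * b ^ 4

/-- A vertex of a tree-like region disagrees with all but one of its neighbours with probability
bounded below. -/
theorem IsTreeLike.orthantConst_le_flip (h : IsTreeLike G d x (2 * R + 3))
    (hd : (d : ℝ) = q + 1) (hq : 2 ≤ q) (hb : b ^ 2 * q = 1)
    (hε : ε = 1 ∨ ε = -1) (hR : 1 ≤ R) {a δ W : ℝ} (hδ : 0 < δ) (hW : 0 < W)
    (h1 : δ * waveNorm R b ≤ a * waveNorm R b - q * (2 * R * b))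
    (h2 : δ * waveNorm R b ≤ waveNorm R b + (q - 1) * waveNbr q R b - a * (2 * R * b))
    (h3 : a ^ 2 * waveNorm R b - 2 * a * q * (2 * R * b) +
      q * (waveNorm R b + (q - 1) * waveNbr q R b) ≤ W ^ 2 * waveNorm R b) :
    orthantConst d (δ / W) ≤ (labelLaw V).real {g | ε * signField G (ε * b) R g x *
      nbrSum G (signField G (ε * b) R g) x ≤ -1} := by
  classical
  have hq0 : 0 < q := by linarith
  have hε2 : ε ^ 2 = 1 := by rcases hε with rfl | rfl <;> norm_num
  have hεε : ε * ε = 1 := by rw [← sq, hε2]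
  have hβ : (ε * b) ^ 2 * q = 1 := by rw [mul_pow, hε2, one_mul, hb]
  set N := waveNorm R b with hNdef
  set p := 2 * R * b with hp
  set t := waveNbr q R b with ht
  have hN : 1 + R + R * (ε * b) ^ 2 = N := by rw [mul_pow, hε2, one_mul, hNdef, waveNorm]
  have hNpos : 0 < N := waveNorm_pos R b
  set v : V → V → ℝ := wave G (ε * b) R with hv
  have hxx : v x ⬝ᵥ v x = N := by rw [hv, h.wave_self (by omega) hd hq0 hβ, hN]
  have hyy : ∀ y, G.Adj x y → v y ⬝ᵥ v y = N := fun y hy => by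
    rw [hv, h.wave_nbr_self (by omega) hd hq0 hβ hR hy, hN]
  have hxy : ∀ y, G.Adj x y → v x ⬝ᵥ v y = ε * p := fun y hy => by
    rw [hv, h.wave_center_nbr (by omega) hd hq0 hβ hR hy]; ring
  have hyy' : ∀ y y', G.Adj x y → G.Adj x y' → y ≠ y' → v y ⬝ᵥ v y' = t := fun y y' hy hy' hne => by
    rw [hv, h.wave_nbr_nbr (by omega) hd hq0 hβ hR hy hy' hne, ht, waveNbr]
    rw [mul_pow, mul_pow, hε2, show ε ^ 4 = (ε ^ 2) ^ 2 by ring, hε2]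
    ring
  have hdeg := h.degree_eq (k := 0) (z := x) (by omega) (by simp)
  have hdpos : 0 < d := by
    rcases Nat.eq_zero_or_pos d with h0 | h0
    · rw [h0] at hd; push_cast at hd; linarith
    · exact h0
  -- One neighbour must be left out. As R → ∞ the sum of all d neighbouring waves approaches 2ε√q
  -- times the wave at x, so disagreement with all of them has vanishing probability.
  obtain ⟨y₀, hy₀⟩ : (G.neighborFinset x).Nonempty := Finset.card_pos.1 (by omega)
  set Y := (G.neighborFinset x).erase y₀ with hY
  have hYadj : ∀ y ∈ Y, G.Adj x y := fun y hy => by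
    simpa using Finset.mem_of_mem_erase hy
  have hYcard : (Y.card : ℝ) = q := by
    rw [hY, Finset.card_erase_of_mem hy₀, hdeg, degree_sub_one_cast hd hq0]
  have hxY : x ∉ Y := fun hx => G.loopless.irrefl x (hYadj x hx)
  set w : V → ℝ := a • v x - ε • ∑ y ∈ Y, v y with hw
  have hwx : w ⬝ᵥ v x = a * N - q * p := by
    rw [hw, sub_dotProduct, smul_dotProduct, smul_dotProduct, sum_dotProduct, hxx,
      Finset.sum_congr rfl fun y hy => by rw [dotProduct_comm, hxy y (hYadj y hy)],
      Finset.sum_const, nsmul_eq_mul, hYcard, smul_eq_mul, smul_eq_mul]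
    linear_combination (-(q * p)) * hεε
  have hYsum : ∀ y ∈ Y, (∑ y' ∈ Y, v y') ⬝ᵥ v y = N + (q - 1) * t := by
    intro y hy
    rw [sum_dotProduct, ← Finset.add_sum_erase _ _ hy, hyy y (hYadj y hy),
      Finset.sum_congr rfl fun y' hy' => hyy' y' y (hYadj y' (Finset.mem_of_mem_erase hy'))
        (hYadj y hy) (Finset.ne_of_mem_erase hy'), Finset.sum_const, nsmul_eq_mul,
      Finset.card_erase_of_mem hy, Nat.cast_sub (Finset.card_pos.2 ⟨y, hy⟩), hYcard, Nat.cast_one]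
  have hwy : ∀ y ∈ Y, w ⬝ᵥ v y = -ε * (N + (q - 1) * t - a * p) := by
    intro y hy
    rw [hw, sub_dotProduct, smul_dotProduct, smul_dotProduct, hYsum y hy, hxy y (hYadj y hy),
      smul_eq_mul, smul_eq_mul]
    ring
  have hww : w ⬝ᵥ w = a ^ 2 * N - 2 * a * q * p + q * (N + (q - 1) * t) := by
    have e1 : w ⬝ᵥ ∑ y ∈ Y, v y = q * (-ε * (N + (q - 1) * t - a * p)) := by
      rw [dotProduct_sum, Finset.sum_congr rfl hwy, Finset.sum_const, nsmul_eq_mul, hYcard]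
    have e2 : w ⬝ᵥ w = a * (w ⬝ᵥ v x) - ε * (w ⬝ᵥ ∑ y ∈ Y, v y) := by
      nth_rewrite 2 [hw]
      rw [dotProduct_sub, dotProduct_smul, dotProduct_smul, smul_eq_mul, smul_eq_mul]
    rw [e2, e1, hwx]
    linear_combination (q * (N + (q - 1) * t - a * p)) * hεε
  have hw0 : 0 < w ⬝ᵥ w := by
    refine lt_of_le_of_ne (Finset.sum_nonneg fun i _ => mul_self_nonneg _) fun h0 => ?_
    rw [dotProduct_self_eq_zero.1 h0.symm, zero_dotProduct] at hwx
    nlinarith [mul_pos hδ hNpos]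
  set m := Real.sqrt N with hm
  set k := Real.sqrt (w ⬝ᵥ w) with hk
  have hm2 : m * m = N := Real.mul_self_sqrt hNpos.le
  have hm0 : 0 < m := Real.sqrt_pos.2 hNpos
  have hk2 : k * k = w ⬝ᵥ w := Real.mul_self_sqrt hw0.le
  have hk0 : 0 < k := Real.sqrt_pos.2 hw0
  have hkW : k ≤ W * m := by
    refine Real.sqrt_le_iff.2 ⟨by positivity, ?_⟩
    rw [mul_pow, sq m, hm2, hww]
    exact h3
  -- Unit vectors whose forms are all positive exactly when the form at x is positive and ε times
  -- each form at Y is negative.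
  set f : V → V → ℝ := fun z => if z = x then m⁻¹ • v x else (-ε * m⁻¹) • v z with hf
  have hfx : f x = m⁻¹ • v x := if_pos rfl
  have hfy : ∀ y ∈ Y, f y = (-ε * m⁻¹) • v y := fun y hy =>
    if_neg fun (e : y = x) => hxY (e ▸ hy)
  -- After normalising w (length k ≤ Wm) and the wave (length m = √N), a product of at least δN
  -- becomes a correlation of at least δ/W, with no R left.
  have hκ : ∀ r, δ * N ≤ r → δ / W ≤ k⁻¹ * (m⁻¹ * r) := by
    intro r hr
    rw [div_le_iff₀ hW]
    have : k⁻¹ * (m⁻¹ * r) * W = r * W / (k * m) := by field_simp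
    rw [this, le_div_iff₀ (by positivity)]
    calc δ * (k * m) ≤ δ * (W * m * m) := by gcongr
      _ = δ * N * W := by rw [← hm2]; ring
      _ ≤ r * W := by gcongr
  refine (orthantConst_le_label (insert x Y) f (k⁻¹ • w) (m := d) (κ := δ / W) ?_ hdpos
    (by positivity) ?_ ?_ ?_).trans (measureReal_mono ?_ (measure_ne_top _ _))
  · rw [Finset.card_insert_of_notMem hxY, hY, Finset.card_erase_of_mem hy₀, hdeg]
    omega
  · rw [smul_dotProduct, dotProduct_smul, ← hk2, smul_eq_mul, smul_eq_mul]
    field_simp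
  · intro z hz
    rcases Finset.mem_insert.1 hz with rfl | hz
    · rw [hfx, smul_dotProduct, dotProduct_smul, hxx, ← hm2, smul_eq_mul, smul_eq_mul]
      field_simp
    · rw [hfy z hz, smul_dotProduct, dotProduct_smul, hyy z (hYadj z hz), ← hm2, smul_eq_mul,
        smul_eq_mul]
      field_simp
      exact hε2
  · intro z hz
    rcases Finset.mem_insert.1 hz with rfl | hz
    · rw [hfx, smul_dotProduct, dotProduct_smul, hwx, smul_eq_mul, smul_eq_mul]
      exact hκ _ h1
    · rw [hfy z hz, smul_dotProduct, dotProduct_smul, hwy z hz, smul_eq_mul, smul_eq_mul,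
        show -ε * m⁻¹ * (-ε * (N + (q - 1) * t - a * p)) =
          (ε * ε) * (m⁻¹ * (N + (q - 1) * t - a * p)) by ring, hεε, one_mul]
      exact hκ _ h2
  · intro g hg
    have hsx : signField G (ε * b) R g x = 1 := by
      have := hg x (Finset.mem_insert_self _ _)
      rw [hfx, smul_dotProduct, smul_eq_mul, mul_pos_iff_of_pos_left (inv_pos.2 hm0)] at this
      exact Real.sign_of_pos this
    have hsy : ∀ y ∈ Y, ε * signField G (ε * b) R g y = -1 := by
      intro y hy
      have := hg y (Finset.mem_insert_of_mem hy)
      rw [hfy y hy, smul_dotProduct, smul_eq_mul, show -ε * m⁻¹ * (v y ⬝ᵥ g) =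
        m⁻¹ * (-ε * (v y ⬝ᵥ g)) by ring, mul_pos_iff_of_pos_left (inv_pos.2 hm0)] at this
      rw [signField]
      rcases hε with rfl | rfl
      · rw [Real.sign_of_neg (by linarith), one_mul]
      · rw [Real.sign_of_pos (by linarith), mul_one]
    have hle : ε * signField G (ε * b) R g y₀ ≤ 1 := by
      refine (le_abs_self _).trans ?_
      rw [abs_mul, show |ε| = 1 by rcases hε with rfl | rfl <;> simp, one_mul]
      exact abs_signField_le G _ R g y₀
    -- The q disagreeing neighbours give −q and the omitted one at most 1; q ≥ 2 makes the total at
    -- most −1.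
    rw [Set.mem_ofPred_eq, hsx, mul_one, nbrSum, Finset.mul_sum, ← Finset.add_sum_erase _ _ hy₀,
      ← hY, Finset.sum_congr rfl hsy, Finset.sum_const, nsmul_eq_mul, hYcard]
    linarith

end Flip

/-! ### Limits of the correlations as the cutoff grows -/

section Asymptotics

theorem tendsto_affine_div_affine (a a' c c' : ℝ) (hc : c ≠ 0) :
    Tendsto (fun R : ℕ => (a * R + a') / (c * R + c')) atTop (𝓝 (a / c)) := by
  have h1 : ∀ a a' : ℝ, Tendsto (fun R : ℕ => a + a' * (R : ℝ)⁻¹) atTop (𝓝 a) := fun a a' => by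
    have := (tendsto_inv_atTop_nhds_zero_nat (𝕜 := ℝ)).const_mul a' |>.const_add a
    simpa using this
  refine ((h1 a a').div (h1 c c') hc).congr' ?_
  filter_upwards [eventually_gt_atTop 0] with R hR
  have : (R : ℝ) ≠ 0 := by positivity
  rw [Pi.div_apply, ← mul_div_mul_right (a + a' * (R : ℝ)⁻¹) (c + c' * (R : ℝ)⁻¹) this]
  congr 1 <;> field_simp

theorem tendsto_wave_corr (b : ℝ) :
    Tendsto (fun R : ℕ => 2 * R * b / waveNorm R b) atTop (𝓝 (2 * b / (1 + b ^ 2))) := by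
  refine (tendsto_affine_div_affine (2 * b) 0 (1 + b ^ 2) 1 (by positivity)).congr fun R => ?_
  unfold waveNorm
  congr 1 <;> ring

theorem tendsto_waveNbr (q b : ℝ) : Tendsto (fun R : ℕ => waveNbr q R b / waveNorm R b) atTop
    (𝓝 ((2 * b ^ 2 + (q - 1) * b ^ 4) / (1 + b ^ 2))) := by
  refine (tendsto_affine_div_affine (2 * b ^ 2 + (q - 1) * b ^ 4) (- b ^ 2 - (q - 1) * b ^ 4)
    (1 + b ^ 2) 1 (by positivity)).congr fun R => ?_
  unfold waveNorm waveNbr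
  congr 1 <;> ring

/-- The direction is a times the wave at x minus ε times the sum of q neighbouring waves. The first
two inequalities make it correlate correctly with each of these waves, and the third bounds its
length. In the limit such an a exists precisely when qρ² < 1 + (q − 1)σ, where ερ and σ are the
limiting correlations of a vertex with a neighbour and of two neighbours. Constants chosen strictly
in the limit then serve all large R at once. -/
theorem exists_flip_direction {q b : ℝ} (hq : 2 ≤ q) (hb : b ^ 2 * q = 1) (hb0 : 0 < b) :
    ∃ a δ W : ℝ, 0 < δ ∧ 0 < W ∧ ∀ᶠ R : ℕ in atTop,
      δ * waveNorm R b ≤ a * waveNorm R b - q * (2 * R * b) ∧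
      δ * waveNorm R b ≤ waveNorm R b + (q - 1) * waveNbr q R b - a * (2 * R * b) ∧
      a ^ 2 * waveNorm R b - 2 * a * q * (2 * R * b) +
        q * (waveNorm R b + (q - 1) * waveNbr q R b) ≤ W ^ 2 * waveNorm R b := by
  set ρ := 2 * b / (1 + b ^ 2) with hρ
  set σ := (2 * b ^ 2 + (q - 1) * b ^ 4) / (1 + b ^ 2) with hσ
  have hρ0 : 0 < ρ := by rw [hρ]; positivity
  have hkey : q * ρ < (1 + (q - 1) * σ) / ρ := by
    rw [lt_div_iff₀ hρ0]
    have hb2 : b ^ 2 = 1 / q := by field_simp; linarith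
    have e1 : q * ρ * ρ = 4 * q ^ 2 / (q + 1) ^ 2 := by
      rw [hρ, show q * (2 * b / (1 + b ^ 2)) * (2 * b / (1 + b ^ 2)) =
        4 * q * b ^ 2 / (1 + b ^ 2) ^ 2 by field_simp; ring, hb2]
      field_simp
    have e2 : 1 + (q - 1) * σ = (4 * q ^ 2 - 3 * q + 1) / (q * (q + 1)) := by
      rw [hσ, show b ^ 4 = (b ^ 2) ^ 2 by ring, hb2]
      field_simp
      ring
    rw [e1, e2, div_lt_div_iff₀ (by positivity) (by positivity)]
    -- This is exactly the difference of the two sides after clearing denominators.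
    have : 0 < (q + 1) * (q - 1) ^ 2 := by
      have : 0 < q - 1 := by linarith
      positivity
    nlinarith
  obtain ⟨a, ha1, ha2⟩ := exists_between hkey
  rw [lt_div_iff₀ hρ0] at ha2
  obtain ⟨δ, hδ0, hδ⟩ := exists_between
    (show 0 < min (a - q * ρ) (1 + (q - 1) * σ - a * ρ) from lt_min (by linarith) (by linarith))
  obtain ⟨W, hW0, hW⟩ : ∃ W : ℝ, 0 < W ∧
      a ^ 2 - 2 * a * q * ρ + q * (1 + (q - 1) * σ) < W ^ 2 := by
    set z := a ^ 2 - 2 * a * q * ρ + q * (1 + (q - 1) * σ)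
    refine ⟨|z| + 1, by positivity, ?_⟩
    nlinarith [abs_nonneg z, le_abs_self z]
  have t1 := tendsto_wave_corr b
  have t2 := tendsto_waveNbr q b
  rw [← hρ] at t1
  rw [← hσ] at t2
  have l1 := (t1.const_mul q).const_sub a
  have l2 := ((t2.const_mul (q - 1)).const_add 1).sub (t1.const_mul a)
  have l3 := ((t1.const_mul (2 * a * q)).const_sub (a ^ 2)).add
    (((t2.const_mul (q - 1)).const_add 1).const_mul q)
  refine ⟨a, δ, W, hδ0, hW0, ?_⟩
  filter_upwards [l1.eventually_const_lt (hδ.trans_le (min_le_left _ _)),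
    l2.eventually_const_lt (hδ.trans_le (min_le_right _ _)), l3.eventually_lt_const hW]
    with R h1 h2 h3
  have hN := waveNorm_pos R b
  have hc : 2 * R * b = 2 * R * b / waveNorm R b * waveNorm R b := by field_simp
  have ht : waveNbr q R b = waveNbr q R b / waveNorm R b * waveNorm R b := by field_simp
  generalize 2 * R * b / waveNorm R b = u at *
  generalize waveNbr q R b / waveNorm R b = u' at *
  rw [hc, ht]
  refine ⟨?_, ?_, ?_⟩
  · nlinarith [mul_lt_mul_of_pos_right h1 hN]
  · nlinarith [mul_lt_mul_of_pos_right h2 hN]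
  · nlinarith [mul_lt_mul_of_pos_right h3 hN]

end Asymptotics

/-! ### Gain along the sequence of graphs -/

section Sequence

/-- A maximal independent subset of A dominates A, and each of its members dominates at most d + 1
vertices. -/
theorem exists_independent_subset {V : Type*} [Fintype V] (G : SimpleGraph V) (A : Finset V)
    (d : ℕ) (hA : ∀ x ∈ A, Nat.card (G.neighborSet x) = d) :
    ∃ I ⊆ A, (∀ x ∈ I, ∀ y ∈ I, ¬ G.Adj x y) ∧ A.card ≤ I.card * (d + 1) := by
  classical
  obtain ⟨I, hI, hmax⟩ := (A.powerset.filter fun I => ∀ x ∈ I, ∀ y ∈ I, ¬ G.Adj x y).exists_maximal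
    ⟨∅, by simp⟩
  rw [Finset.mem_filter, Finset.mem_powerset] at hI
  refine ⟨I, hI.1, hI.2, ?_⟩
  have hsub : A ⊆ I.biUnion fun x => insert x (G.neighborFinset x) := by
    intro x hx
    by_contra hc
    simp only [Finset.mem_biUnion, Finset.mem_insert, SimpleGraph.mem_neighborFinset, not_exists,
      not_and, not_or] at hc
    have hxI : x ∉ I := fun h => (hc x h).1 rfl
    have hmem : insert x I ∈ A.powerset.filter fun I => ∀ x ∈ I, ∀ y ∈ I, ¬ G.Adj x y := by
      rw [Finset.mem_filter, Finset.mem_powerset]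
      refine ⟨Finset.insert_subset hx hI.1, ?_⟩
      intro y hy z hz
      rcases Finset.mem_insert.1 hy with rfl | hy' <;>
        rcases Finset.mem_insert.1 hz with rfl | hz'
      · exact G.loopless.irrefl _
      · exact fun h => (hc z hz').2 h.symm
      · exact (hc y hy').2
      · exact hI.2 y hy' z hz'
    exact hxI (hmax hmem (Finset.subset_insert x I) (Finset.mem_insert_self x I))
  refine (Finset.card_le_card hsub).trans (Finset.card_biUnion_le_card_mul _ _ _ fun x hx => ?_)
  refine (Finset.card_insert_le _ _).trans ?_
  rw [SimpleGraph.card_neighborFinset_eq_degree, ← hA x (hI.1 hx), Nat.card_eq_fintype_card,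
    SimpleGraph.card_neighborSet_eq_degree]

variable {V : ℕ → Type*} [∀ n, Fintype (V n)] {G : ∀ n, SimpleGraph (V n)} {d : ℕ}

/-- A single tree-like vertex already forces a branch level of (d − 1)^M > M vertices. Divergence of
N is what makes the balancing cost of order √N negligible. -/
theorem RandomWeakLimitTree.tendsto_card (hG : RandomWeakLimitTree G d) (hd : 3 ≤ d) :
    Tendsto (fun n => (Fintype.card (V n) : ℝ)) atTop atTop := by
  refine tendsto_natCast_atTop_atTop.comp (tendsto_atTop.2 fun M => ?_)
  filter_upwards [(hG (M + 2) (by omega)).eventually_const_lt (show (0 : ℝ) < 1 by norm_num)]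
    with n hn
  have hne : ∃ x, RootedBallIso (G n) x (regularTree d) (treeRoot d) (M + 2) := by
    classical
    by_contra! hc
    rw [treeBallProb, Finset.filter_false_of_mem (fun x _ => hc x)] at hn
    simp at hn
  obtain ⟨x, hx⟩ := hne
  have ht := hx.isTreeLike
  have h0 := ht.card_nbr 0 x (by omega) (by simp)
  have : Nonempty ((G n).neighborSet x) := by
    by_contra hc
    rw [not_nonempty_iff] at hc
    rw [Nat.card_of_isEmpty] at h0
    omega
  obtain ⟨y, hy⟩ := this
  have h1 := ht.card_branch hy M (by omega)
  have h2 := Finset.card_le_univ (branch (G n) x y M)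
  have h3 : M < (d - 1) ^ M := Nat.lt_pow_self (by omega)
  omega

theorem sum_card_neighborSet_div {V : Type*} [Fintype V] (G : SimpleGraph V) :
    (∑ x, (Nat.card (G.neighborSet x) : ℝ)) / Fintype.card V = averageDegree G := by
  classical
  rw [averageDegree]
  congr 1
  refine Finset.sum_congr rfl fun x _ => ?_
  rw [Nat.card_eq_fintype_card, SimpleGraph.card_neighborSet_eq_degree]

/-- Bisections that beat the sign of the Gaussian wave by a positive amount. -/
theorem exists_bisection_gain {q b : ℝ} (hd : (d : ℝ) = q + 1) (hq : 2 ≤ q) (hb : b ^ 2 * q = 1)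
    (hb0 : 0 < b) (hG : RandomWeakLimitTree G d)
    (havg : Tendsto (fun n => averageDegree (G n)) atTop (𝓝 d)) :
    ∃ η : ℝ, 0 < η ∧ ∀ ε : ℝ, ε = 1 ∨ ε = -1 → ∀ᶠ n in atTop, 0 < Fintype.card (V n) ∧
      ∃ S ∈ bisections (V n),
        d * (1 - 2 * Real.arccos (2 * b / (1 + b ^ 2)) / Real.pi) + η ≤
          ε * adjForm (G n) (spin S) / Fintype.card (V n) := by
  classical
  have hd3 : 3 ≤ d := by
    have : (3 : ℝ) ≤ d := by linarith
    exact_mod_cast this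
  have hq0 : 0 < q := by linarith
  obtain ⟨a, δ, W, hδ, hW, hev⟩ := exists_flip_direction hq hb hb0
  set c := orthantConst d (δ / W) with hc
  have hc0 : 0 < c := orthantConst_pos _ _
  set η := c / (d + 1) with hη
  have hη0 : 0 < η := by positivity
  set L := d * (1 - 2 * Real.arccos (2 * b / (1 + b ^ 2)) / Real.pi) with hL
  have hlim : Tendsto (fun R : ℕ =>
      d * (1 - 2 * Real.arccos (2 * R * b / waveNorm R b) / Real.pi)) atTop (𝓝 L) :=
    ((((Real.continuous_arccos.tendsto _).comp (tendsto_wave_corr b)).const_mul 2).div_const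
      Real.pi).const_sub 1 |>.const_mul _
  -- Truncation may cost up to η because the reversals bring in 4η; η was fixed before R. From here
  -- on R is fixed and only n grows.
  obtain ⟨R, ⟨h1, h2, h3⟩, hK, hR⟩ := (hev.and ((hlim.eventually_const_lt
    (show L - η < L by linarith)).and (eventually_ge_atTop 1))).exists
  set K := d * (1 - 2 * Real.arccos (2 * R * b / waveNorm R b) / Real.pi) with hKdef
  set C := Nat.card (graphBall (regularTree d) (treeRoot d) (2 * R + 3)) with hC
  refine ⟨η, hη0, fun ε hε => ?_⟩
  set N : ℕ → ℝ := fun n => Fintype.card (V n) with hN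
  set α : ℕ → ℝ := fun n => treeBallProb (G n) d (2 * R + 3) with hα
  have hNlim : Tendsto N atTop atTop := hG.tendsto_card hd3
  have hαlim : Tendsto α atTop (𝓝 1) := hG (2 * R + 3) (by omega)
  have hsqrt : Tendsto (fun n => (C + 1) / 2 * (Real.sqrt (N n))⁻¹) atTop (𝓝 ((C + 1) / 2 * 0)) :=
    ((tendsto_inv_atTop_zero.comp (Real.tendsto_sqrt_atTop.comp hNlim))).const_mul _
  have hB : Tendsto (fun n => α n * K - (averageDegree (G n) - α n * d) + 4 * (α n * η) -
      2 * d * ((1 - α n) + (C + 1) / 2 * (Real.sqrt (N n))⁻¹)) atTop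
      (𝓝 (1 * K - (d - 1 * d) + 4 * (1 * η) - 2 * d * ((1 - 1) + (C + 1) / 2 * 0))) :=
    (((hαlim.mul_const K).sub (havg.sub (hαlim.mul_const _))).add
      ((hαlim.mul_const η).const_mul 4)).sub (((hαlim.const_sub 1).add hsqrt).const_mul _)
  filter_upwards [hB.eventually_const_lt (show L + η < _ by linarith),
    hαlim.eventually_const_lt (show (1 / 2 : ℝ) < 1 by norm_num), hNlim.eventually_gt_atTop 0]
    with n hn hαn hNn
  refine ⟨Nat.cast_pos.1 hNn, ?_⟩
  set A : Finset (V n) := Finset.univ.filter fun x =>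
    RootedBallIso (G n) x (regularTree d) (treeRoot d) (2 * R + 3) with hA
  have hAα : (A.card : ℝ) = α n * N n := by
    rw [hα, hN]
    simp only [treeBallProb]
    rw [div_mul_cancel₀ _ hNn.ne']
  have hAtree : ∀ x ∈ A, IsTreeLike (G n) d x (2 * R + 3) := fun x hx =>
    (Finset.mem_filter.1 hx).2.isTreeLike
  obtain ⟨I, hIA, hI, hIcard⟩ := exists_independent_subset (G n) A d fun x hx =>
    (hAtree x hx).card_neighborSet
  -- Here a = √N, which makes the fluctuation bound (NC/a + a)/2 of order √N.
  obtain ⟨S, hS, hle⟩ := exists_bisection_ge A I hIA hI hAtree C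
    (fun x hx => (Finset.mem_filter.1 hx).2.card_ball.le)
    (by
      have : (Fintype.card (V n) : ℝ) ≤ 2 * A.card := by
        rw [hAα]
        nlinarith
      exact_mod_cast this) hd hq0 hb hb0 hε hR (c := c) (Real.sqrt_pos.2 hNn)
    (fun x hx => (hAtree x hx).orthantConst_le_flip hd hq hb hε hR hδ hW h1 h2 h3)
  refine ⟨S, hS, ?_⟩
  rw [le_div_iff₀ hNn]
  refine le_trans ?_ hle
  have hdeg : (∑ x, (Nat.card ((G n).neighborSet x) : ℝ)) = averageDegree (G n) * N n := by
    rw [← sum_card_neighborSet_div, div_mul_cancel₀ _ hNn.ne']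
  have hIη : α n * N n * η ≤ I.card * c := by
    have : (A.card : ℝ) ≤ I.card * (d + 1) := by exact_mod_cast hIcard
    rw [← hAα, hη, mul_div_assoc', div_le_iff₀ (by positivity)]
    nlinarith
  have hs0 := Real.sqrt_pos.2 hNn
  have hs2 := Real.mul_self_sqrt hNn.le
  have hsq : (N n * C / Real.sqrt (N n) + Real.sqrt (N n)) / 2 =
      (C + 1) / 2 * (Real.sqrt (N n))⁻¹ * N n := by
    field_simp
    linear_combination hs2
  have hmul := mul_lt_mul_of_pos_right hn hNn
  change (L + η) * N n ≤ A.card * K - (_ - A.card * d) + 4 * (I.card * c) -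
    2 * d * ((N n - A.card) + (N n * C / Real.sqrt (N n) + Real.sqrt (N n)) / 2)
  rw [hdeg, hsq, hAα]
  generalize (C + 1) / 2 * (Real.sqrt (N n))⁻¹ = u at *
  linarith

end Sequence

/-! ### Numerical value of the constant for d = 3 -/

section Numerics

/-- The imaginary part of the order 8 remainder bound for the exponential at ix. -/
theorem abs_sin_sub_taylor_le {x : ℝ} (hx : |x| ≤ 1) :
    |Real.sin x - (x - x ^ 3 / 6 + x ^ 5 / 120 - x ^ 7 / 5040)| ≤ |x| ^ 8 * (9 / 322560) := by
  have hn : ‖(x : ℂ) * Complex.I‖ = |x| := by simp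
  have h := Complex.exp_bound (x := x * Complex.I) (by rw [hn]; exact hx) (n := 8) (by norm_num)
  rw [hn] at h
  have h1 := (Complex.abs_im_le_norm _).trans h
  have e : (Complex.exp (x * Complex.I) -
      ∑ m ∈ Finset.range 8, (x * Complex.I) ^ m / (m.factorial : ℂ)).im =
      Real.sin x - (x - x ^ 3 / 6 + x ^ 5 / 120 - x ^ 7 / 5040) := by
    have e1 : ∑ m ∈ Finset.range 8, ((x : ℂ) * Complex.I) ^ m / (m.factorial : ℂ) =
        ((1 - x ^ 2 / 2 + x ^ 4 / 24 - x ^ 6 / 720 : ℝ) : ℂ) +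
          ((x - x ^ 3 / 6 + x ^ 5 / 120 - x ^ 7 / 5040 : ℝ) : ℂ) * Complex.I := by
      simp only [Finset.sum_range_succ, Finset.sum_range_zero, Nat.factorial, mul_pow]
      have i2 : Complex.I ^ 2 = -1 := Complex.I_sq
      have i3 : Complex.I ^ 3 = -Complex.I := Complex.I_pow_three
      have i4 : Complex.I ^ 4 = 1 := Complex.I_pow_four
      have i5 : Complex.I ^ 5 = Complex.I := by rw [pow_succ, i4, one_mul]
      have i6 : Complex.I ^ 6 = -1 := by rw [show 6 = 4 + 2 by rfl, pow_add, i4, i2, one_mul]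
      have i7 : Complex.I ^ 7 = -Complex.I := by rw [show 7 = 4 + 3 by rfl, pow_add, i4, i3, one_mul]
      rw [i2, i3, i4, i5, i6, i7]
      push_cast
      ring
    rw [e1, Complex.sub_im, Complex.exp_ofReal_mul_I_im, Complex.add_im, Complex.ofReal_im,
      Complex.im_ofReal_mul]
    simp
  rw [e] at h1
  refine h1.trans (mul_le_mul_of_nonneg_left ?_ (by positivity))
  norm_num [Nat.factorial]

theorem sin_arccos_sqrt : Real.sin (Real.arccos (Real.sqrt (8 / 9))) = 1 / 3 := by
  rw [Real.sin_arccos, Real.sq_sqrt (by norm_num), show (1 : ℝ) - 8 / 9 = (1 / 3) ^ 2 by norm_num,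
    Real.sqrt_sq (by norm_num)]

theorem arccos_sqrt_bounds : 0.33983688 < Real.arccos (Real.sqrt (8 / 9)) ∧
    Real.arccos (Real.sqrt (8 / 9)) < 0.33983694 := by
  have hpi := Real.pi_gt_three
  have h0 := Real.arccos_nonneg (Real.sqrt (8 / 9))
  have h1 : Real.arccos (Real.sqrt (8 / 9)) ≤ Real.pi / 2 :=
    Real.arccos_le_pi_div_two.2 (Real.sqrt_nonneg _)
  have hmono := Real.strictMonoOn_sin
  -- The sine of the angle is 1/3, so by monotonicity it suffices to compare the sines of the two
  -- rational endpoints with 1/3.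
  have a1 := (abs_le.1 (abs_sin_sub_taylor_le (x := 0.33983688) (by norm_num))).2
  have a2 := (abs_le.1 (abs_sin_sub_taylor_le (x := 0.33983694) (by norm_num))).1
  rw [abs_of_pos (by norm_num)] at a1 a2
  constructor
  · rw [← hmono.lt_iff_lt ⟨by linarith, by linarith⟩ ⟨by linarith, h1⟩, sin_arccos_sqrt]
    norm_num at a1 ⊢
    linarith
  · rw [← hmono.lt_iff_lt ⟨by linarith, h1⟩ ⟨by linarith, by linarith⟩, sin_arccos_sqrt]
    norm_num at a2 ⊢
    linarith

theorem arccos_sqrt_scaled_bounds :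
    0.16226015 < 3 / (2 * Real.pi) * Real.arccos (Real.sqrt (8 / 9)) ∧
      3 / (2 * Real.pi) * Real.arccos (Real.sqrt (8 / 9)) < 0.1622602 := by
  obtain ⟨h1, h2⟩ := arccos_sqrt_bounds
  have p1 := Real.pi_gt_d20
  have p2 := Real.pi_lt_d20
  have hpi := Real.pi_pos
  rw [div_mul_eq_mul_div, lt_div_iff₀ (by positivity), div_lt_iff₀ (by positivity)]
  constructor
  · norm_num at *
    linarith
  · norm_num at *
    linarith

end Numerics

/-! ### From the gain in the quadratic form to the bisection limits -/

section Limits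

variable {V : ℕ → Type*} [∀ n, Fintype (V n)] {G : ∀ n, SimpleGraph (V n)} {d : ℕ}

theorem cutSize_div_card {V : Type*} [Fintype V] (G : SimpleGraph V) (S : Finset V) :
    (cutSize G S : ℝ) / Fintype.card V =
      (averageDegree G - adjForm G (spin S) / Fintype.card V) / 4 := by
  rw [cutSize_eq, averageDegree]
  ring

/-- Strict bounds for the bisection limits in terms of the neighbour correlation of the Gaussian
wave. -/
theorem bisection_limits {q b θ : ℝ} (hd : (d : ℝ) = q + 1) (hq : 2 ≤ q) (hb : b ^ 2 * q = 1)
    (hb0 : 0 < b) (hθ : Real.arccos (2 * b / (1 + b ^ 2)) = θ) (hG : RandomWeakLimitTree G d)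
    (havg : Tendsto (fun n => averageDegree (G n)) atTop (𝓝 d)) :
    MinBi G < ((d / (2 * Real.pi) * θ : ℝ) : EReal) ∧
      ((d / (2 * Real.pi) * (Real.pi - θ) : ℝ) : EReal) < MaxBi G := by
  obtain ⟨η, hη, h⟩ := exists_bisection_gain hd hq hb hb0 hG havg
  rw [hθ] at h
  have hpi := Real.pi_pos
  have e1 : d * (1 - 2 * θ / Real.pi) = d - 4 * (d / (2 * Real.pi) * θ) := by field_simp; ring
  have e2 : d / (2 * Real.pi) * (Real.pi - θ) = d / 2 - d / (2 * Real.pi) * θ := by field_simp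
  rw [e1] at h
  rw [e2]
  generalize d / (2 * Real.pi) * θ = u at *
  constructor
  -- The gain η in the form is worth η/4 in the cut; letting the average degree deviate by η/2 uses
  -- up half of that.
  · refine lt_of_le_of_lt (b := ((u - η / 8 : ℝ) : EReal)) ?_ (by
      rw [EReal.coe_lt_coe_iff]; linarith)
    refine limsup_le_of_le (by isBoundedDefault) ?_
    filter_upwards [h 1 (Or.inl rfl), havg.eventually_lt_const
      (show (d : ℝ) < d + η / 2 by linarith)] with n ⟨_, S, hS, hle⟩ hn
    rw [EReal.coe_le_coe_iff]
    refine (Finset.inf'_le _ hS).trans ?_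
    rw [cutSize_div_card]
    rw [one_mul] at hle
    linarith
  · refine lt_of_lt_of_le (b := ((d / 2 - u + η / 8 : ℝ) : EReal)) (by
      rw [EReal.coe_lt_coe_iff]; linarith) ?_
    refine le_liminf_of_le (by isBoundedDefault) ?_
    filter_upwards [h (-1) (Or.inr rfl), havg.eventually_const_lt
      (show (d : ℝ) - η / 2 < d by linarith)] with n ⟨_, S, hS, hle⟩ hn
    rw [EReal.coe_le_coe_iff]
    refine le_trans ?_ (Finset.le_sup' (fun S => (cutSize (G n) S : ℝ) / Fintype.card (V n)) hS)
    rw [cutSize_div_card]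
    rw [neg_one_mul, neg_div] at hle
    linarith

end Limits

/-! ### The cases d = 3 and d = 4 -/

theorem theoremt {V : ℕ → Type*} [∀ n, Fintype (V n)] (G : ∀ n, SimpleGraph (V n)) :
    (RandomWeakLimitTree G 3 → Tendsto (fun n => averageDegree (G n)) atTop (𝓝 3) →
      MinBi G < ((3 / (2 * Real.pi) * Real.arccos (Real.sqrt (8 / 9)) : ℝ) : EReal) ∧
      ((3 / (2 * Real.pi) * Real.arccos (-Real.sqrt (8 / 9)) : ℝ) : EReal) < MaxBi G) ∧
    (RandomWeakLimitTree G 4 → Tendsto (fun n => averageDegree (G n)) atTop (𝓝 4) →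
      MinBi G < ((1 / 3 : ℝ) : EReal) ∧
      ((5 / 3 : ℝ) : EReal) < MaxBi G) ∧
    (0.16226015 < 3 / (2 * Real.pi) * Real.arccos (Real.sqrt (8 / 9)) ∧
      3 / (2 * Real.pi) * Real.arccos (Real.sqrt (8 / 9)) < 0.1622602) ∧
    (1.3377398 < 3 / (2 * Real.pi) * Real.arccos (-Real.sqrt (8 / 9)) ∧
      3 / (2 * Real.pi) * Real.arccos (-Real.sqrt (8 / 9)) < 1.33773985) := by
  have hpi := Real.pi_pos
  refine ⟨fun hG havg => ?_, fun hG havg => ?_, arccos_sqrt_scaled_bounds, ?_⟩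
  · have h2 : Real.sqrt 2 ^ 2 = 2 := Real.sq_sqrt (by norm_num)
    have h2' : 0 < Real.sqrt 2 := by positivity
    have hρ : 2 * (1 / Real.sqrt 2) / (1 + (1 / Real.sqrt 2) ^ 2) = Real.sqrt (8 / 9) := by
      symm
      rw [Real.sqrt_eq_iff_mul_self_eq (by norm_num) (by positivity), div_pow, h2]
      field_simp
      rw [h2]
      norm_num
    have := bisection_limits (G := G) (d := 3) (q := 2) (b := 1 / Real.sqrt 2) (by norm_num)
      le_rfl (by rw [div_pow, h2]; norm_num) (by positivity) rfl hG (by exact_mod_cast havg)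
    rw [hρ] at this
    rw [Real.arccos_neg]
    exact_mod_cast this
  · have h3 : Real.sqrt 3 ^ 2 = 3 := Real.sq_sqrt (by norm_num)
    have h3' : 0 < Real.sqrt 3 := by positivity
    -- For d = 4 the limiting correlation 2√3/4 is the cosine of π/6, so the bounds become rational.
    have hρ : 2 * (1 / Real.sqrt 3) / (1 + (1 / Real.sqrt 3) ^ 2) = Real.cos (Real.pi / 6) := by
      rw [Real.cos_pi_div_six, div_pow, h3]
      field_simp
      rw [h3]
      norm_num
    have := bisection_limits (G := G) (d := 4) (q := 3) (b := 1 / Real.sqrt 3) (θ := Real.pi / 6)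
      (by norm_num) (by norm_num) (by rw [div_pow, h3]; norm_num) (by positivity)
      (by rw [hρ, Real.arccos_cos (by positivity) (by linarith)]) hG (by exact_mod_cast havg)
    have e1 : ((4 : ℕ) : ℝ) / (2 * Real.pi) * (Real.pi / 6) = 1 / 3 := by
      push_cast
      field_simp
      norm_num
    have e2 : ((4 : ℕ) : ℝ) / (2 * Real.pi) * (Real.pi - Real.pi / 6) = 5 / 3 := by
      push_cast
      field_simp
      norm_num
    rwa [e1, e2] at this
  · obtain ⟨h1, h2⟩ := arccos_sqrt_scaled_bounds
    have e : 3 / (2 * Real.pi) * Real.arccos (-Real.sqrt (8 / 9)) =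
        3 / 2 - 3 / (2 * Real.pi) * Real.arccos (Real.sqrt (8 / 9)) := by
      rw [Real.arccos_neg]
      field_simp
    rw [e]
    norm_num at *
    constructor <;> linarith
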